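/- Let $\mathcal G_0$ be the space of right continuous nondecreasing maps $g:[0,1[\,\to[0,1]$, each extended to $[0,1]$ by $g(1):=1$. For $\beta>0$ let $\mathbb Q_0^\beta$ (the Dirichlet process) be the probability measure on $\mathcal G_0$ such that for all $0=t_0<t_1<\dots<t_N<t_{N+1}=1$ the vector $(g(t_1),\dots,g(t_N))$ has, with $x_0=0$, $x_{N+1}=1$, the density $$\frac{\Gamma(\beta)}{\prod_{i=0}^{N}\Gamma(\beta(t_{i+1}-t_i))}\prod_{i=0}^{N}(x_{i+1}-x_i)^{\beta(t_{i+1}-t_i)-1}$$ on $\{0<x_1<\dots<x_N<1\}$ with respect to $dx_1\cdots dx_N$. Let $\chi(g)=g_*\mathrm{Leb}$ be the image of Lebesgue measure on $[0,1]$ under $g$, and let the entropic measure $\mathbb P_0^\beta=\chi_*\mathbb Q_0^\beta$ be the image of $\mathbb Q_0^\beta$ on $\mathcal P([0,1])$. Let $h$ be a $C^2$-isomorphism of $[0,1]$, i.e. an increasing homeomorphism $h:[0,1]\to[0,1]$ such that $h$ and $h^{-1}$ are $C^2$ on $[0,1]$. Put $\tau_h(g)=h\circ g$ and $$X_h^\beta(g)=\exp\Big(\beta\int_0^1\log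 h'(g(s))\,ds\Big),\qquad Y_h^0(g)=\prod_{a\in J_g}\frac{\sqrt{h'(g(a-))\,h'(g(a+))}}{\dfrac{h(g(a+))-h(g(a-))}{g(a+)-g(a-)}},$$ $$Y_{h,0}^\beta(g)=\frac{X_h^\beta(g)\,Y_h^0(g)}{\sqrt{h'(0)\,h'(1)}},$$ where $J_g\subset\,]0,1[$ is the set of jump locations of $g$. **(Dirichlet process.)** The product defining $Y_h^0(g)$ converges (unconditionally) for every $g\in\mathcal G_0$, and there are constants $0<c\le C<\infty$, depending only on $\beta$ and $h$, with $c\le Y_{h,0}^\beta(g)\le C$ for all $g\in\mathcal G_0$. The measure $\mathbb Q_0^\beta$ is quasi-invariant under $\tau_h$, that is, $(\tau_h)_*\mathbb Q_0^\beta$ and $\mathbb Q_0^\beta$ are mutually absolutely continuous, and $d\mathbb Q_0^\beta(h\circ g)=Y_{h,0}^\beta(g)\,d\mathbb Q_0^\beta(g)$, i.e. $$\frac{d(\tau_{h^{-1}})_*\mathbb Q_0^\beta}{d\mathbb Q_0^\beta}(g)=Y_{h,0}^\beta(g).$$ **(Entropic measure.)** For $\mu\in\mathcal P([0,1])$ let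 $\mathrm{gaps}(\mu)$ be the set of nonempty open intervals $I=\,]I_-,I_+[\,\subset[0,1]$ of maximal length with $\mu(I)=0$. The product below converges (unconditionally) for every $\mu$; the measure $\mathbb P_0^\beta$ is quasi-invariant under $\mu\mapsto h_*\mu$ (its image and itself are mutually absolutely continuous), and $$\frac{d\mathbb P_0^\beta(h_*\mu)}{d\mathbb P_0^\beta(\mu)}=\exp\Big[\beta\int_0^1\log h'(s)\,\mu(ds)\Big]\cdot\frac1{\sqrt{h'(0)\,h'(1)}}\cdot\prod_{I\in\mathrm{gaps}(\mu)}\frac{\sqrt{h'(I_-)\,h'(I_+)}}{|h(I)|/|I|},$$ i.e. the right-hand side is the density of the image of $\mathbb P_0^\beta$ under $\mu\mapsto(h^{-1})_*\mu$ with respect to $\mathbb P_0^\beta$. -/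

import Mathlib

open MeasureTheory Set
open scoped unitInterval

namespace EntropicMeasure

/-- The space `𝒢₀` of right continuous nondecreasing maps `g : [0,1[ → [0,1]`, each of them
extended to the full interval `[0,1]` by `g(1) := 1`. -/
structure G0 where
  toFun : I → I
  monotone' : Monotone toFun
  rightCts' : ∀ t : I, ContinuousWithinAt toFun (Ici t) t
  map_one' : toFun 1 = 1

instance : CoeFun G0 (fun _ => I → I) := ⟨G0.toFun⟩

/-- The `σ`-algebra on `𝒢₀` generated by the evaluations `g ↦ g(t)`, `t ∈ [0,1]`.  (It is also the
Borel `σ`-algebra of the `L²`-distance.) -/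
instance : MeasurableSpace G0 :=
  MeasurableSpace.comap (fun g : G0 => (g : I → I)) MeasurableSpace.pi

/-- A map between intervals, regarded as a function on the real line (only its values on
`[0,1]` matter). -/
noncomputable def extFun (h : I ≃o I) : ℝ → ℝ :=
  fun x => (h (projIcc 0 1 zero_le_one x) : ℝ)

/-- `h` is a `C²`-isomorphism of `[0,1]`: an increasing homeomorphism of `[0,1]` such that `h`
and `h⁻¹` are of class `C²` on the closed interval `[0,1]`. -/
def IsC2Iso (h : I ≃o I) : Prop :=
  ContDiffOn ℝ 2 (extFun h) (Icc 0 1) ∧ ContDiffOn ℝ 2 (extFun h.symm) (Icc 0 1)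

/-- The derivative `h'` on `[0,1]` (one-sided at the endpoints). -/
noncomputable def dh (h : I ≃o I) (x : I) : ℝ :=
  derivWithin (extFun h) (Icc 0 1) x

/-- The translation `τ_h : 𝒢₀ → 𝒢₀`, `g ↦ h ∘ g`. -/
def tau (h : I ≃o I) (g : G0) : G0 where
  toFun := h ∘ g
  monotone' := h.monotone.comp g.monotone'
  rightCts' := fun t => h.continuous.continuousAt.comp_continuousWithinAt (g.rightCts' t)
  map_one' := by
    have h1 : h 1 = 1 := h.map_top
    simp [g.map_one', h1]

/-- The points `0 = x_0, x_1, …, x_N, x_{N+1} = 1`, for given `x_1, …, x_N`. -/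
def withEnds {N : ℕ} (x : Fin N → ℝ) : Fin (N + 2) → ℝ :=
  Fin.cons (α := fun _ => ℝ) 0 (Fin.snoc (α := fun _ => ℝ) x 1)

open Classical in
/-- For points `0 < t_1 < … < t_N < 1` and with `t_0 = x_0 = 0`, `t_{N+1} = x_{N+1} = 1`, the
function which on `{0 < x_1 < … < x_N < 1}` equals
`Γ(β) / ∏_{i=0}^N Γ(β (t_{i+1} - t_i)) * ∏_{i=0}^N (x_{i+1} - x_i) ^ (β (t_{i+1} - t_i) - 1)`,
and vanishes elsewhere. -/
noncomputable def dirichletDensity (β : ℝ) {N : ℕ} (t x : Fin N → ℝ) : ℝ :=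
  if StrictMono (withEnds x) then
    Real.Gamma β /
        (∏ i : Fin (N + 1), Real.Gamma (β * (withEnds t i.succ - withEnds t i.castSucc))) *
      ∏ i : Fin (N + 1), (withEnds x i.succ - withEnds x i.castSucc) ^
        (β * (withEnds t i.succ - withEnds t i.castSucc) - 1)
  else 0

/-- `Q` is the Dirichlet process `ℚ₀^β`: the probability measure on `𝒢₀` for which, for every
`0 < t_1 < … < t_N < 1`, the vector `(g(t_1), …, g(t_N))` has the density `dirichletDensity β t`
with respect to Lebesgue measure.  (A measure on `𝒢₀` is determined by these distributions.) -/
structure IsDirichletProcess (β : ℝ) (Q : Measure G0) : Prop where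
  isProbabilityMeasure : IsProbabilityMeasure Q
  finiteDimensional : ∀ (N : ℕ) (t : Fin N → I), StrictMono t → (∀ i, 0 < t i ∧ t i < 1) →
    Q.map (fun g i => (g (t i) : ℝ)) =
      (volume : Measure (Fin N → ℝ)).withDensity
        (fun x => ENNReal.ofReal (dirichletDensity β (fun i => (t i : ℝ)) x))

/-- The set `J_g ⊆ ]0,1[` of jump locations of `g`. -/
def jumps (g : G0) : Set I :=
  {a | 0 < a ∧ a < 1 ∧ Function.leftLim g a < g a}

/-- `√(h'(x) h'(y)) / ((h(y) - h(x)) / (y - x))` -/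
noncomputable def jumpFactor (h : I ≃o I) (x y : I) : ℝ :=
  √(dh h x * dh h y) / (((h y : ℝ) - (h x : ℝ)) / ((y : ℝ) - (x : ℝ)))

/-- `X_h^β(g) = exp (β ∫₀¹ log h'(g(s)) ds)` -/
noncomputable def X (β : ℝ) (h : I ≃o I) (g : G0) : ℝ :=
  Real.exp (β * ∫ s : I, Real.log (dh h (g s)))

/-- `Y_h^0(g)`, the product of the factors `jumpFactor h (g(a-)) (g(a+))` over all jump locations
`a`; by right continuity, `g(a+) = g(a)`. -/
noncomputable def Y0 (h : I ≃o I) (g : G0) : ℝ :=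
  ∏' a : jumps g, jumpFactor h (Function.leftLim g a) (g a)

/-- `Y_{h,0}^β(g) = X_h^β(g) Y_h^0(g) / √(h'(0) h'(1))` -/
noncomputable def Y (β : ℝ) (h : I ≃o I) (g : G0) : ℝ :=
  X β h g * (1 / √(dh h 0 * dh h 1) * Y0 h g)

/-- The map `χ : 𝒢₀ → 𝒫([0,1])`, `g ↦ g_* Leb`. -/
noncomputable def chi (g : G0) : ProbabilityMeasure I :=
  ProbabilityMeasure.map ⟨(volume : Measure I), inferInstance⟩ g.monotone'.measurable.aemeasurable

/-- The transformation `μ ↦ h_* μ` of `𝒫([0,1])`. -/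
noncomputable def pushforward (h : I ≃o I) (μ : ProbabilityMeasure I) : ProbabilityMeasure I :=
  μ.map (f := h) h.continuous.measurable.aemeasurable

/-- The gaps of `μ`, an interval `]I₋, I₊[ ⊆ [0,1]` being represented by the pair `(I₋, I₊)`:
the nonempty open intervals of maximal length with `μ(]I₋, I₊[) = 0`. -/
def gaps (μ : ProbabilityMeasure I) : Set (I × I) :=
  {p | p.1 < p.2 ∧ (μ : Measure I) (Ioo p.1 p.2) = 0 ∧
    ∀ q : I × I, q.1 ≤ p.1 → p.2 ≤ q.2 → (μ : Measure I) (Ioo q.1 q.2) = 0 → q = p}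

/-- The density `exp (β ∫ log h' dμ) / √(h'(0) h'(1)) * ∏_{I ∈ gaps(μ)} √(h'(I₋) h'(I₊)) /
(|h(I)| / |I|)`. -/
noncomputable def gapDensity (β : ℝ) (h : I ≃o I) (μ : ProbabilityMeasure I) : ℝ :=
  Real.exp (β * ∫ s : I, Real.log (dh h s) ∂(μ : Measure I)) * (1 / √(dh h 0 * dh h 1)) *
    ∏' p : gaps μ, jumpFactor h p.1.1 p.1.2

end EntropicMeasure

/-! The finite-dimensional laws are explicit, so the density can be computed exactly on each
partition and then passed to the limit. Under `x ↦ h(x)` in every coordinate, the Dirichlet density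
picks up the Jacobian `∏ h'(x_i)`, and each increment is multiplied by the slope `s_i` of `h`
between neighbouring points. The ratio of densities is therefore `∏ h'(x_i) · ∏ s_i ^ (β Δt_i - 1)`.
Sharing each `h'(x_i)` between its two adjacent intervals turns this into `1 / √(h'(0) h'(1))`,
times `exp (β ∑ Δt_i log s_i)`, times the product over all partition intervals of `√(h'(x_i)
h'(x_{i+1})) / s_i` (`dirichletRatio_nodeValues`).

The analytic heart is that the logarithm of such a factor is `o(y - x)` near the diagonal, because
`h'` is `C¹`. Hence the factor is `exp ((y - x) r(x, y))` with `r` continuous on the square and zero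
on the diagonal (`continuous_logJumpRate`). As disjoint intervals have total length at most one,
boundedness of `r` alone gives convergence of the products and the two-sided bounds. Along a
partition, `∑ (x_{i+1} - x_i) r(x_i, x_{i+1})` with `x_i = g(t_i)` is a Riemann sum in the range of
`g`. Its limit sees only the jumps, since `r` vanishes where `g` is continuous
(`integral_comp_leftInv`). This yields `tendsto_YApprox`, provided `g(0) = 0` and `g(1-) = 1`; both
hold almost surely because `g(t)` has mean `t`.

The approximate densities are exact on the increasing σ-algebras of dyadic evaluations and uniformly
bounded, so dominated convergence identifies the density on all dyadic cylinder sets, which generate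
(`map_tau_symm`). The entropic case is a transport: `χ` is a measurable isomorphism with the
quantile function as inverse, it conjugates `τ_h` to `μ ↦ h_* μ`, and it carries jumps to gaps. -/

namespace EntropicMeasure
open Filter Topology

/-! ### The derivative of a `C²`-isomorphism -/

section Derivative

variable {h : I ≃o I}

lemma extFun_apply (h : I ≃o I) (x : I) : extFun h x = h x := by
  simp [extFun]

lemma extFun_of_mem (h : I ≃o I) {x : ℝ} (hx : x ∈ Icc (0 : ℝ) 1) :
    extFun h x = h ⟨x, hx⟩ := extFun_apply h ⟨x, hx⟩

lemma IsC2Iso.symm (hh : IsC2Iso h) : IsC2Iso h.symm := ⟨hh.2, hh.1⟩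

lemma IsC2Iso.contDiffOn_derivWithin (hh : IsC2Iso h) :
    ContDiffOn ℝ 1 (derivWithin (extFun h) (Icc 0 1)) (Icc 0 1) :=
  hh.1.derivWithin (uniqueDiffOn_Icc zero_lt_one) (by norm_num)

lemma IsC2Iso.hasDerivWithinAt (hh : IsC2Iso h) (x : I) :
    HasDerivWithinAt (extFun h) (dh h x) (Icc 0 1) x :=
  ((hh.1.differentiableOn (by norm_num)) x x.2).hasDerivWithinAt

lemma IsC2Iso.continuous_dh (hh : IsC2Iso h) : Continuous (dh h) :=
  hh.contDiffOn_derivWithin.continuousOn.domRestrict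

/-- Monotonicity gives the weak sign, and the chain rule for `h.symm ∘ h = id` excludes zero. -/
lemma IsC2Iso.dh_pos (hh : IsC2Iso h) (x : I) : 0 < dh h x := by
  have h0 : 0 ≤ dh h x := by
    refine MonotoneOn.derivWithin_nonneg ?_
    intro a _ b _ hab
    exact h.monotone (monotone_projIcc _ hab)
  have h1 := hh.symm.hasDerivWithinAt (h x)
  rw [← extFun_apply] at h1
  have h2 := h1.comp (x : ℝ) (hh.hasDerivWithinAt x)
    (fun y hy => by rw [extFun_of_mem h hy]; exact (h ⟨y, hy⟩).2)
  have h3 : HasDerivWithinAt (extFun h.symm ∘ extFun h) 1 (Icc 0 1) x := by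
    refine (hasDerivWithinAt_id (x : ℝ) (Icc 0 1)).congr_of_mem (fun y hy => ?_) x.2
    rw [Function.comp_apply, extFun_of_mem h hy, extFun_apply]
    simp
  have h4 := (uniqueDiffOn_Icc zero_lt_one (x : ℝ) x.2).eq_deriv _ h2 h3
  rcases h0.lt_or_eq with h5 | h5
  · exact h5
  · rw [← h5] at h4; simp at h4

lemma IsC2Iso.exists_dh_bounds (hh : IsC2Iso h) :
    ∃ m M : ℝ, 0 < m ∧ ∀ x, m ≤ dh h x ∧ dh h x ≤ M := by
  obtain ⟨a, ha⟩ := hh.continuous_dh.exists_forall_le_of_hasCompactSupport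
    (HasCompactSupport.of_compactSpace _)
  obtain ⟨b, hb⟩ := hh.continuous_dh.exists_forall_ge_of_hasCompactSupport
    (HasCompactSupport.of_compactSpace _)
  exact ⟨dh h a, dh h b, hh.dh_pos a, fun x => ⟨ha x, hb x⟩⟩

/-- The mean value of `h'` over the segment between `x` and `y`, that is, the slope of `h` if
`x < y`. -/
noncomputable def slopeI (h : I ≃o I) (x y : I) : ℝ :=
  ∫ u in (0 : ℝ)..1, dh h (projIcc 0 1 zero_le_one ((x : ℝ) + (y - x) * u))

/-- The integral form of the slope, unlike the difference quotient, is continuous across the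
diagonal. -/
lemma IsC2Iso.continuous_slopeI (hh : IsC2Iso h) :
    Continuous (fun p : I × I => slopeI h p.1 p.2) := by
  unfold slopeI
  refine intervalIntegral.continuous_parametric_intervalIntegral_of_continuous' ?_ 0 1
  have := hh.continuous_dh
  have h2 : Continuous (projIcc (0 : ℝ) 1 zero_le_one) := continuous_projIcc
  unfold Function.uncurry
  fun_prop

lemma slopeI_self (h : I ≃o I) (x : I) : slopeI h x x = dh h x := by
  simp [slopeI]

lemma IsC2Iso.continuous_dh_projIcc (hh : IsC2Iso h) :
    Continuous fun z : ℝ => dh h (projIcc 0 1 zero_le_one z) :=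
  hh.continuous_dh.comp continuous_projIcc

lemma IsC2Iso.intervalIntegrable_dh_projIcc (hh : IsC2Iso h) (x c a b : ℝ) :
    IntervalIntegrable (fun u : ℝ => dh h (projIcc 0 1 zero_le_one (x + c * u))) volume a b := by
  exact (hh.continuous_dh_projIcc.comp (g := fun z : ℝ => dh h (projIcc 0 1 zero_le_one z))
    (f := fun u : ℝ => x + c * u) (by fun_prop)).intervalIntegrable _ _

lemma IsC2Iso.le_slopeI (hh : IsC2Iso h) {m : ℝ} (hm : ∀ x, m ≤ dh h x) (x y : I) :
    m ≤ slopeI h x y := by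
  have := intervalIntegral.integral_mono_on (a := 0) (b := 1) (μ := volume) zero_le_one
    (f := fun _ => m) (by simp) (hh.intervalIntegrable_dh_projIcc x (y - x) 0 1)
    (fun u _ => hm _)
  simpa [slopeI] using this

lemma IsC2Iso.slopeI_pos (hh : IsC2Iso h) (x y : I) : 0 < slopeI h x y := by
  obtain ⟨m, M, hm, hb⟩ := hh.exists_dh_bounds
  exact hm.trans_le (hh.le_slopeI (fun x => (hb x).1) x y)

lemma IsC2Iso.slopeI_mul (hh : IsC2Iso h) {x y : I} (hxy : x ≤ y) :
    ((y : ℝ) - x) * slopeI h x y = h y - h x := by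
  have h1 := intervalIntegral.smul_integral_comp_add_mul (a := 0) (b := 1)
    (fun z => dh h (projIcc 0 1 zero_le_one z)) ((y : ℝ) - x) x
  rw [slopeI, ← smul_eq_mul, h1]
  simp only [mul_zero, add_zero, mul_one, add_sub_cancel]
  have hsub : Icc (x : ℝ) y ⊆ Icc 0 1 := Icc_subset_Icc x.2.1 y.2.2
  rw [intervalIntegral.integral_eq_sub_of_hasDerivAt_of_le (f := extFun h) (by exact_mod_cast hxy),
    extFun_apply, extFun_apply]
  · exact hh.1.continuousOn.mono hsub
  · intro z hz
    have hz' : z ∈ Icc (0 : ℝ) 1 := hsub (Ioo_subset_Icc_self hz)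
    rw [projIcc_of_mem _ hz']
    refine (hh.hasDerivWithinAt ⟨z, hz'⟩).hasDerivAt (Icc_mem_nhds ?_ ?_)
    · exact x.2.1.trans_lt hz.1
    · exact hz.2.trans_le y.2.2
  · exact hh.continuous_dh_projIcc.intervalIntegrable _ _

lemma IsC2Iso.slopeI_eq_div (hh : IsC2Iso h) {x y : I} (hxy : x < y) :
    slopeI h x y = ((h y : ℝ) - h x) / ((y : ℝ) - x) := by
  have h1 : (x : ℝ) < y := hxy
  rw [← hh.slopeI_mul hxy.le, mul_div_cancel_left₀ _ (by linarith)]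

/-- The jump factor with its continuous extension to the diagonal. -/
noncomputable def jumpFactorExt (h : I ≃o I) (x y : I) : ℝ :=
  √(dh h x * dh h y) / slopeI h x y

/-- The logarithm of the jump factor, divided by the length of the jump. -/
noncomputable def logJumpRate (h : I ≃o I) (x y : I) : ℝ :=
  Real.log (jumpFactorExt h x y) / (y - x)

lemma IsC2Iso.jumpFactorExt_of_lt (hh : IsC2Iso h) {x y : I} (hxy : x < y) :
    jumpFactorExt h x y = jumpFactor h x y := by
  rw [jumpFactorExt, jumpFactor, hh.slopeI_eq_div hxy]

lemma IsC2Iso.jumpFactorExt_pos (hh : IsC2Iso h) (x y : I) : 0 < jumpFactorExt h x y :=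
  div_pos (Real.sqrt_pos.2 (mul_pos (hh.dh_pos x) (hh.dh_pos y))) (hh.slopeI_pos x y)

lemma IsC2Iso.jumpFactorExt_self (hh : IsC2Iso h) (x : I) : jumpFactorExt h x x = 1 := by
  rw [jumpFactorExt, slopeI_self, Real.sqrt_mul_self (hh.dh_pos x).le, div_self (hh.dh_pos x).ne']

lemma IsC2Iso.continuous_jumpFactorExt (hh : IsC2Iso h) :
    Continuous (fun p : I × I => jumpFactorExt h p.1 p.2) := by
  have h1 := hh.continuous_dh
  unfold jumpFactorExt
  exact Continuous.div (by fun_prop) hh.continuous_slopeI (fun p => (hh.slopeI_pos _ _).ne')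

/-- Division by zero yields 0, which is also the limit at the diagonal. -/
lemma logJumpRate_self (h : I ≃o I) (x : I) : logJumpRate h x x = 0 := by
  simp [logJumpRate]

lemma IsC2Iso.exp_logJumpRate (hh : IsC2Iso h) (x y : I) :
    Real.exp (((y : ℝ) - x) * logJumpRate h x y) = jumpFactorExt h x y := by
  by_cases hxy : x = y
  · subst hxy; simp [hh.jumpFactorExt_self]
  · have : (y : ℝ) - x ≠ 0 := sub_ne_zero.2 fun e => hxy (Subtype.ext e.symm)
    rw [logJumpRate, mul_div_cancel₀ _ this, Real.exp_log (hh.jumpFactorExt_pos x y)]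

/-- Strict differentiability of `h'`. -/
lemma IsC2Iso.exists_dh_sub_sub_le (hh : IsC2Iso h) (x₀ : I) :
    ∃ d : ℝ, ∀ ε > 0, ∃ δ > 0, ∀ x y : I, dist x x₀ < δ → dist y x₀ < δ →
      |dh h y - dh h x - d * (y - x)| ≤ ε * |(y : ℝ) - x| := by
  set D := derivWithin (extFun h) (Icc 0 1)
  set D2 := derivWithin D (Icc 0 1)
  have hD : ContDiffOn ℝ 1 D (Icc 0 1) := hh.contDiffOn_derivWithin
  have hD2 : ContinuousOn D2 (Icc 0 1) :=
    hD.continuousOn_derivWithin (uniqueDiffOn_Icc zero_lt_one) le_rfl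
  refine ⟨D2 x₀, fun ε hε => ?_⟩
  obtain ⟨δ, hδ, hδ'⟩ := Metric.continuousWithinAt_iff.1 (hD2 x₀ x₀.2) ε hε
  refine ⟨δ, hδ, fun x y hx hy => ?_⟩
  have hconv : Convex ℝ (Icc (0 : ℝ) 1 ∩ Metric.ball (x₀ : ℝ) δ) :=
    (convex_Icc 0 1).inter (convex_ball _ _)
  -- Mean value inequality for `D` minus its linear part at `x₀`: near `x₀` the derivative of the
  -- difference is at most `ε`.
  have := hconv.norm_image_sub_le_of_norm_hasDerivWithin_le (f := fun z => D z - D2 x₀ * z)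
    (f' := fun z => D2 z - D2 x₀) (C := ε) (x := x) (y := y) ?_ ?_ ⟨x.2, hx⟩ ⟨y.2, hy⟩
  · rw [Real.norm_eq_abs, Real.norm_eq_abs] at this
    convert this using 2
    simp only [dh, D]; ring
  · intro z hz
    have h1 : HasDerivWithinAt D (D2 z) (Icc 0 1) z :=
      ((hD.differentiableOn (by norm_num)) z hz.1).hasDerivWithinAt
    have h2 := h1.sub ((hasDerivWithinAt_id z (Icc 0 1)).const_mul (D2 x₀))
    simp only [mul_one] at h2
    exact h2.mono inter_subset_left
  · intro z hz
    exact (hδ' hz.1 hz.2).le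

/-- From `log u ≤ u - 1`, applied to `a / b` and to `b / a`. -/
lemma abs_log_div_le {m a b : ℝ} (hm : 0 < m) (ha : m ≤ a) (hb : m ≤ b) :
    |Real.log (a / b)| ≤ |a - b| / m := by
  have key : ∀ {a b : ℝ}, m ≤ a → m ≤ b → Real.log (a / b) ≤ |a - b| / m := by
    intro a b ha hb
    have hb0 : 0 < b := hm.trans_le hb
    calc Real.log (a / b) ≤ a / b - 1 := Real.log_le_sub_one_of_pos (div_pos (hm.trans_le ha) hb0)
      _ = (a - b) / b := by field_simp
      _ ≤ |a - b| / b := by gcongr; exact le_abs_self _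
      _ ≤ |a - b| / m := by gcongr
  rw [abs_le]
  refine ⟨?_, key ha hb⟩
  have h1 := key hb ha
  rw [← inv_div, Real.log_inv, abs_sub_comm] at h1
  linarith

/-- Multiplying the difference of geometric and arithmetic mean by their sum, which is at least `m`,
gives `-(a - b)² / 4`. -/
lemma abs_sqrt_mul_sub_le {m a b : ℝ} (hm : 0 < m) (ha : m ≤ a) (hb : m ≤ b) :
    |√(a * b) - (a + b) / 2| ≤ (a - b) ^ 2 / m := by
  have ha0 : 0 < a := hm.trans_le ha
  have hb0 : 0 < b := hm.trans_le hb
  have hs : √(a * b) * √(a * b) = a * b := Real.mul_self_sqrt (by positivity)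
  have hs0 : 0 ≤ √(a * b) := Real.sqrt_nonneg _
  rw [le_div_iff₀ hm]
  have h1 : |√(a * b) - (a + b) / 2| * (√(a * b) + (a + b) / 2) = (a - b) ^ 2 / 4 := by
    have hp : 0 < √(a * b) + (a + b) / 2 := by positivity
    rw [← abs_of_pos hp]
    rw [← abs_mul]
    rw [show (√(a * b) - (a + b) / 2) * (√(a * b) + (a + b) / 2) = -((a - b) ^ 2 / 4) by
      nlinarith, abs_neg, abs_of_nonneg (by positivity)]
  have h2 : |√(a * b) - (a + b) / 2| * m ≤
      |√(a * b) - (a + b) / 2| * (√(a * b) + (a + b) / 2) := by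
    gcongr; linarith
  nlinarith [sq_nonneg (a - b)]

/-- Both `√(h'(x) h'(y))` and the slope agree with the arithmetic mean of `h'(x)` and `h'(y)` up to
`o(|y - x|)`: the first since means differ by a square, the second since `h'` is affine to first
order. So the logarithm of their quotient is `o(|y - x|)`. -/
lemma IsC2Iso.exists_abs_logJumpRate_le (hh : IsC2Iso h) (x₀ : I) {η : ℝ} (hη : 0 < η) :
    ∃ δ > 0, ∀ x y : I, dist x x₀ < δ → dist y x₀ < δ → |logJumpRate h x y| ≤ η := by
  obtain ⟨m, M, hm, hb⟩ := hh.exists_dh_bounds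
  obtain ⟨d, hd⟩ := hh.exists_dh_sub_sub_le x₀
  -- The 2 bounds the error of the slope (`e6`), `(|d| + 1) / m` that of the square root, and the
  -- outer `/ m` comes from the logarithm.
  set C : ℝ := (2 + (|d| + 1) / m) / m with hC
  have hC0 : 0 < C := by positivity
  set ε := min 1 (η / C)
  have hε : 0 < ε := by positivity
  have hε1 : ε ≤ 1 := min_le_left _ _
  have hε2 : C * ε ≤ η := by
    have : ε ≤ η / C := min_le_right _ _
    rwa [le_div_iff₀' hC0] at this
  obtain ⟨δ₁, hδ₁, h1⟩ := hd ε hε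
  obtain ⟨δ₂, hδ₂, h2⟩ := Metric.continuousAt_iff.1 (hh.continuous_dh.continuousAt (x := x₀))
    (ε / 2) (by positivity)
  refine ⟨min δ₁ δ₂, lt_min hδ₁ hδ₂, fun x y hx hy => ?_⟩
  obtain ⟨hx1, hx2⟩ := lt_min_iff.1 hx
  obtain ⟨hy1, hy2⟩ := lt_min_iff.1 hy
  have e1 := h1 x y hx1 hy1
  set L := |(y : ℝ) - x| with hL
  have hL0 : 0 ≤ L := abs_nonneg _
  have e2 : |dh h x - dh h y| ≤ ε := by
    have a1 := h2 hx2
    have a2 := h2 hy2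
    rw [Real.dist_eq] at a1 a2
    rw [abs_lt] at a1 a2
    rw [abs_le]; constructor <;> linarith [a1.1, a1.2, a2.1, a2.2]
  have e3 : |dh h x - dh h y| ≤ (|d| + 1) * L := by
    have : |dh h y - dh h x| ≤ |dh h y - dh h x - d * (y - x)| + |d * (y - x)| := by
      have := abs_add_le (dh h y - dh h x - d * (y - x)) (d * (y - x))
      simpa using this
    rw [abs_sub_comm]
    rw [abs_mul] at this
    nlinarith
  -- One factor is small by continuity, the other is Lipschitz, so the square is `o(L)`.
  have e4 : (dh h x - dh h y) ^ 2 ≤ ε * ((|d| + 1) * L) := by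
    rw [← sq_abs, sq]
    exact mul_le_mul e2 e3 (abs_nonneg _) hε.le
  have e5 : |slopeI h x y - dh h x - d / 2 * (y - x)| ≤ ε * L := by
    have hint := hh.intervalIntegrable_dh_projIcc x (y - x) 0 1
    have q1 : slopeI h x y - dh h x - d / 2 * (y - x) =
        ∫ u in (0 : ℝ)..1, (dh h (projIcc 0 1 zero_le_one ((x : ℝ) + (y - x) * u)) -
          (dh h x + d * (y - x) * u)) := by
      rw [intervalIntegral.integral_sub hint (Continuous.intervalIntegrable (by fun_prop) _ _),
        intervalIntegral.integral_add (by simp)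
          (Continuous.intervalIntegrable (by fun_prop) _ _)]
      rw [intervalIntegral.integral_const, intervalIntegral.integral_const_mul, integral_id, slopeI,
        smul_eq_mul]
      ring
    rw [q1]
    have q2 := intervalIntegral.norm_integral_le_of_norm_le_const (a := 0) (b := 1) (C := ε * L)
      (f := fun u : ℝ => (dh h (projIcc 0 1 zero_le_one ((x : ℝ) + (y - x) * u)) -
          (dh h x + d * (y - x) * u))) ?_
    · simpa using q2
    · intro u hu
      rw [uIoc_of_le zero_le_one] at hu
      have hz : (x : ℝ) + (y - x) * u ∈ Icc (0 : ℝ) 1 := by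
        have b1 := x.2.1; have b2 := x.2.2; have b3 := y.2.1; have b4 := y.2.2
        constructor <;> nlinarith [hu.1, hu.2]
      rw [projIcc_of_mem _ hz]
      have hzδ : dist (⟨_, hz⟩ : I) x₀ < δ₁ := by
        have := convex_ball (x₀ : ℝ) δ₁ hx1 hy1 (show (0 : ℝ) ≤ 1 - u by linarith [hu.2]) hu.1.le
          (by ring)
        rw [Metric.mem_ball] at this
        change dist ((x : ℝ) + (y - x) * u) x₀ < δ₁
        convert this using 2
        simp only [smul_eq_mul]; ring
      have := h1 x ⟨_, hz⟩ hx1 hzδ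
      rw [Real.norm_eq_abs]
      simp only [add_sub_cancel_left] at this
      rw [abs_mul, abs_of_pos hu.1] at this
      calc _ = |dh h ⟨_, hz⟩ - dh h x - d * ((y - x) * u)| := by congr 1; ring
        _ ≤ ε * (|(y : ℝ) - x| * u) := this
        _ ≤ ε * L := by
          gcongr
          exact mul_le_of_le_one_right hL0 hu.2
  -- The first-order term `d / 2 * (y - x)` is common to the arithmetic mean and the slope, and
  -- cancels.
  have e6 : |(dh h x + dh h y) / 2 - slopeI h x y| ≤ 2 * ε * L := by
    rw [abs_le] at e1 e5 ⊢
    constructor <;> linarith [e1.1, e1.2, e5.1, e5.2, mul_nonneg hε.le hL0]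
  have e7 := abs_sqrt_mul_sub_le hm (hb x).1 (hb y).1
  have e8 : |√(dh h x * dh h y) - slopeI h x y| ≤ (2 + (|d| + 1) / m) * ε * L := by
    have q := abs_add_le (√(dh h x * dh h y) - (dh h x + dh h y) / 2)
      ((dh h x + dh h y) / 2 - slopeI h x y)
    rw [sub_add_sub_cancel] at q
    have q2 : (dh h x - dh h y) ^ 2 / m ≤ ε * ((|d| + 1) * L) / m := by gcongr
    have q3 : (2 + (|d| + 1) / m) * ε * L = 2 * ε * L + ε * ((|d| + 1) * L) / m := by ring
    linarith
  have e9 : m ≤ √(dh h x * dh h y) := by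
    apply Real.le_sqrt_of_sq_le
    rw [sq]
    exact mul_le_mul (hb x).1 (hb y).1 hm.le (hh.dh_pos x).le
  have e10 := abs_log_div_le hm e9 (hh.le_slopeI (fun x => (hb x).1) x y)
  rw [logJumpRate, abs_div, jumpFactorExt]
  refine div_le_of_le_mul₀ hL0 hη.le ?_
  calc _ ≤ |√(dh h x * dh h y) - slopeI h x y| / m := e10
    _ ≤ ((2 + (|d| + 1) / m) * ε * L) / m := by gcongr
    _ = C * ε * L := by rw [hC]; ring
    _ ≤ η * L := by gcongr

lemma IsC2Iso.continuous_logJumpRate (hh : IsC2Iso h) :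
    Continuous (fun p : I × I => logJumpRate h p.1 p.2) := by
  rw [continuous_iff_continuousAt]
  rintro ⟨x, y⟩
  by_cases hxy : x = y
  · subst hxy
    rw [Metric.continuousAt_iff]
    intro η hη
    obtain ⟨δ, hδ, h1⟩ := hh.exists_abs_logJumpRate_le x (half_pos hη)
    refine ⟨δ, hδ, fun {p} hp => ?_⟩
    rw [Prod.dist_eq, max_lt_iff] at hp
    rw [logJumpRate_self, dist_zero_right, Real.norm_eq_abs]
    linarith [h1 p.1 p.2 hp.1 hp.2]
  · unfold logJumpRate
    refine ContinuousAt.div ?_ (by fun_prop) (sub_ne_zero.2 fun e => hxy (Subtype.ext e.symm))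
    exact hh.continuous_jumpFactorExt.continuousAt.log (hh.jumpFactorExt_pos x y).ne'

lemma IsC2Iso.exists_abs_logJumpRate_le_forall (hh : IsC2Iso h) :
    ∃ K : ℝ, 0 ≤ K ∧ ∀ x y : I, |logJumpRate h x y| ≤ K := by
  obtain ⟨K, hK⟩ := (isCompact_range hh.continuous_logJumpRate).isBounded.exists_norm_le
  exact ⟨K, (norm_nonneg _).trans (hK _ ⟨(0, 0), rfl⟩), fun x y => hK _ ⟨(x, y), rfl⟩⟩

end Derivative

/-! ### Products over disjoint intervals -/

section Products

variable {ι : Type*} {p : ι → I × I}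

lemma length_nonneg (hp : ∀ i, (p i).1 < (p i).2) (i : ι) :
    0 ≤ ((p i).2 : ℝ) - (p i).1 := sub_nonneg.2 (hp i).le

lemma sum_length_le_one (hp : ∀ i, (p i).1 < (p i).2)
    (hd : Pairwise fun i j => Disjoint (Ioo (p i).1 (p i).2) (Ioo (p j).1 (p j).2))
    (s : Finset ι) : ∑ i ∈ s, (((p i).2 : ℝ) - (p i).1) ≤ 1 := by
  have h1 := sum_measure_le_measure_univ (μ := (volume : Measure I)) (s := s)
    (t := fun i => Ioo (p i).1 (p i).2) (fun i _ => measurableSet_Ioo.nullMeasurableSet)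
    (fun i _ j _ hij => (hd hij).aedisjoint)
  simp only [unitInterval.volume_Ioo, measure_univ] at h1
  rw [← ENNReal.ofReal_sum_of_nonneg (fun i _ => sub_nonneg.2 (hp i).le)] at h1
  exact ENNReal.ofReal_le_one.1 h1

lemma summable_length (hp : ∀ i, (p i).1 < (p i).2)
    (hd : Pairwise fun i j => Disjoint (Ioo (p i).1 (p i).2) (Ioo (p j).1 (p j).2)) :
    Summable fun i => (((p i).2 : ℝ) - (p i).1) :=
  summable_of_sum_le (fun i => sub_nonneg.2 (hp i).le) (sum_length_le_one hp hd)

variable {h : I ≃o I}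

lemma IsC2Iso.summable_logJumpRate (hh : IsC2Iso h) (hp : ∀ i, (p i).1 < (p i).2)
    (hd : Pairwise fun i j => Disjoint (Ioo (p i).1 (p i).2) (Ioo (p j).1 (p j).2)) :
    Summable fun i => (((p i).2 : ℝ) - (p i).1) * logJumpRate h (p i).1 (p i).2 := by
  obtain ⟨K, _, hK⟩ := hh.exists_abs_logJumpRate_le_forall
  refine Summable.of_norm_bounded ((summable_length hp hd).mul_right K) (fun i => ?_)
  rw [norm_mul, Real.norm_eq_abs, Real.norm_eq_abs, abs_of_nonneg (length_nonneg hp i)]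
  exact mul_le_mul_of_nonneg_left (hK _ _) (length_nonneg hp i)

/-- Each factor is the exponential of a length times a bounded rate, and the lengths are summable.
-/
lemma IsC2Iso.hasProd_jumpFactor (hh : IsC2Iso h) (hp : ∀ i, (p i).1 < (p i).2)
    (hd : Pairwise fun i j => Disjoint (Ioo (p i).1 (p i).2) (Ioo (p j).1 (p j).2)) :
    HasProd (fun i => jumpFactor h (p i).1 (p i).2)
      (Real.exp (∑' i, (((p i).2 : ℝ) - (p i).1) * logJumpRate h (p i).1 (p i).2)) := by
  convert (hh.summable_logJumpRate hp hd).hasSum.rexp using 2 with i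
  rw [Function.comp_apply, hh.exp_logJumpRate, hh.jumpFactorExt_of_lt (hp i)]

lemma abs_tsum_logJumpRate_le {K : ℝ} (hK : ∀ x y : I, |logJumpRate h x y| ≤ K)
    (hK0 : 0 ≤ K) (hp : ∀ i, (p i).1 < (p i).2)
    (hd : Pairwise fun i j => Disjoint (Ioo (p i).1 (p i).2) (Ioo (p j).1 (p j).2)) :
    |∑' i, (((p i).2 : ℝ) - (p i).1) * logJumpRate h (p i).1 (p i).2| ≤ K := by
  have h1 := summable_length hp hd
  have h2 := tsum_of_norm_bounded (h1.mul_right K).hasSum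
    (f := fun i => (((p i).2 : ℝ) - (p i).1) * logJumpRate h (p i).1 (p i).2) (fun i => by
      rw [norm_mul, Real.norm_eq_abs, Real.norm_eq_abs, abs_of_nonneg (length_nonneg hp i)]
      exact mul_le_mul_of_nonneg_left (hK _ _) (length_nonneg hp i))
  rw [tsum_mul_right] at h2
  have h3 : ∑' i, (((p i).2 : ℝ) - (p i).1) ≤ 1 :=
    h1.tsum_le_of_sum_le (sum_length_le_one hp hd)
  exact h2.trans (mul_le_of_le_one_left hK0 h3)

end Products

/-! ### Jumps -/

section Jumps

variable {h : I ≃o I}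

lemma jumps_lt (g : G0) (a : jumps g) : Function.leftLim g a < g a := a.2.2.2

lemma pairwise_disjoint_jumps (g : G0) : Pairwise fun a b : jumps g =>
    Disjoint (Ioo (Function.leftLim g a) (g a)) (Ioo (Function.leftLim g b) (g b)) := by
  have key : ∀ a b : jumps g, a < b →
      Disjoint (Ioo (Function.leftLim g a) (g a)) (Ioo (Function.leftLim g b) (g b)) := by
    intro a b hab
    rw [Set.disjoint_left]
    intro x hx hx'
    exact absurd ((g.monotone'.le_leftLim hab).trans_lt hx'.1) hx.2.not_gt
  intro a b hab
  rcases hab.lt_or_gt with h1 | h1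
  · exact key a b h1
  · exact (key b a h1).symm

lemma IsC2Iso.hasProd_jumps (hh : IsC2Iso h) (g : G0) :
    HasProd (fun a : jumps g => jumpFactor h (Function.leftLim g a) (g a))
      (Real.exp (∑' a : jumps g, ((g a : ℝ) - Function.leftLim g a) *
        logJumpRate h (Function.leftLim g a) (g a))) :=
  hh.hasProd_jumpFactor (p := fun a : jumps g => (Function.leftLim g a, g a))
    (jumps_lt g) (pairwise_disjoint_jumps g)

lemma IsC2Iso.Y_eq (hh : IsC2Iso h) (β : ℝ) (g : G0) :
    Y β h g = 1 / √(dh h 0 * dh h 1) * Real.exp (β * (∫ s : I, Real.log (dh h (g s))) +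
      ∑' a : jumps g, ((g a : ℝ) - Function.leftLim g a) *
        logJumpRate h (Function.leftLim g a) (g a)) := by
  rw [Y, X, Y0, (hh.hasProd_jumps g).tprod_eq, Real.exp_add]
  ring

lemma IsC2Iso.exists_abs_log_dh_le (hh : IsC2Iso h) : ∃ L : ℝ, ∀ x, |Real.log (dh h x)| ≤ L := by
  have hc : Continuous fun x => Real.log (dh h x) :=
    hh.continuous_dh.log fun x => (hh.dh_pos x).ne'
  obtain ⟨L, hL⟩ := (isCompact_range hc).isBounded.exists_norm_le
  exact ⟨L, fun x => hL _ ⟨x, rfl⟩⟩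

lemma IsC2Iso.exists_Y_bounds (hh : IsC2Iso h) (β : ℝ) :
    ∃ c C : ℝ, 0 < c ∧ ∀ g : G0, c ≤ Y β h g ∧ Y β h g ≤ C := by
  obtain ⟨K, hK0, hK⟩ := hh.exists_abs_logJumpRate_le_forall
  obtain ⟨L, hL⟩ := hh.exists_abs_log_dh_le
  have hs : 0 < 1 / √(dh h 0 * dh h 1) :=
    one_div_pos.2 (Real.sqrt_pos.2 (mul_pos (hh.dh_pos 0) (hh.dh_pos 1)))
  have key : ∀ g : G0, |β * (∫ s : I, Real.log (dh h (g s))) +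
      ∑' a : jumps g, ((g a : ℝ) - Function.leftLim g a) *
        logJumpRate h (Function.leftLim g a) (g a)| ≤ |β| * L + K := by
    intro g
    have h1 := abs_tsum_logJumpRate_le (p := fun a : jumps g => (Function.leftLim g a, g a))
      hK hK0 (jumps_lt g) (pairwise_disjoint_jumps g)
    have h2 : |∫ s : I, Real.log (dh h (g s))| ≤ L := by
      have := norm_integral_le_of_norm_le_const (μ := (volume : Measure I))
        (f := fun s => Real.log (dh h (g s))) (C := L) (Eventually.of_forall fun s => hL (g s))
      simpa using this
    have h3 := abs_add_le (β * ∫ s : I, Real.log (dh h (g s)))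
      (∑' a : jumps g, ((g a : ℝ) - Function.leftLim g a) *
        logJumpRate h (Function.leftLim g a) (g a))
    rw [abs_mul] at h3
    have h4 := mul_le_mul_of_nonneg_left h2 (abs_nonneg β)
    simp only at h1
    linarith
  refine ⟨1 / √(dh h 0 * dh h 1) * Real.exp (-(|β| * L + K)),
    1 / √(dh h 0 * dh h 1) * Real.exp (|β| * L + K), mul_pos hs (Real.exp_pos _), fun g => ?_⟩
  rw [hh.Y_eq]
  have := abs_le.1 (key g)
  constructor
  · exact mul_le_mul_of_nonneg_left (Real.exp_le_exp.2 this.1) hs.le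
  · exact mul_le_mul_of_nonneg_left (Real.exp_le_exp.2 this.2) hs.le

end Jumps

/-! ### Gaps -/

section Gaps

variable {h : I ≃o I}

/-- If two gaps meet, their union is a null interval containing both, and maximality forces each to
equal it. -/
lemma pairwise_disjoint_gaps (μ : ProbabilityMeasure I) : Pairwise fun p q : gaps μ =>
    Disjoint (Ioo p.1.1 p.1.2) (Ioo q.1.1 q.1.2) := by
  intro p q hpq
  by_contra hd
  obtain ⟨x, hx1, hx2⟩ := Set.not_disjoint_iff.1 hd
  apply hpq
  have hU : Ioo (min p.1.1 q.1.1) (max p.1.2 q.1.2) ⊆ Ioo p.1.1 p.1.2 ∪ Ioo q.1.1 q.1.2 := by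
    intro z hz
    simp only [mem_Ioo, mem_union, min_lt_iff, lt_max_iff] at hz hx1 hx2 ⊢
    rcases lt_trichotomy z x with h1 | h1 | h1
    · rcases hz.1 with h2 | h2
      · exact Or.inl ⟨h2, h1.trans hx1.2⟩
      · exact Or.inr ⟨h2, h1.trans hx2.2⟩
    · exact Or.inl (h1 ▸ hx1)
    · rcases hz.2 with h2 | h2
      · exact Or.inl ⟨hx1.1.trans h1, h2⟩
      · exact Or.inr ⟨hx2.1.trans h1, h2⟩
  have h0 : (μ : Measure I) (Ioo (min p.1.1 q.1.1) (max p.1.2 q.1.2)) = 0 :=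
    measure_mono_null hU (measure_union_null p.2.2.1 q.2.2.1)
  have e1 := p.2.2.2 (min p.1.1 q.1.1, max p.1.2 q.1.2) (min_le_left _ _) (le_max_left _ _) h0
  have e2 := q.2.2.2 (min p.1.1 q.1.1, max p.1.2 q.1.2) (min_le_right _ _) (le_max_right _ _) h0
  exact Subtype.ext (e1.symm.trans e2)

lemma IsC2Iso.hasProd_gaps (hh : IsC2Iso h) (μ : ProbabilityMeasure I) :
    HasProd (fun p : gaps μ => jumpFactor h p.1.1 p.1.2)
      (Real.exp (∑' p : gaps μ, ((p.1.2 : ℝ) - p.1.1) * logJumpRate h p.1.1 p.1.2)) :=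
  hh.hasProd_jumpFactor (p := fun q : gaps μ => q.1) (fun q => q.2.1) (pairwise_disjoint_gaps μ)

end Gaps

/-! ### Sums along equidistant partitions -/

section Partition

/-- The point `i / m`. -/
noncomputable def node (m i : ℕ) : I := projIcc 0 1 zero_le_one ((i : ℝ) / m)

lemma coe_node {m i : ℕ} (hm : 0 < m) (hi : i ≤ m) : (node m i : ℝ) = i / m := by
  rw [node, projIcc_of_mem]
  exact ⟨by positivity, div_le_one_of_le₀ (by exact_mod_cast hi) (by positivity)⟩

lemma node_zero (m : ℕ) : node m 0 = 0 := by
  simp [node]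

lemma node_self {m : ℕ} (hm : 0 < m) : node m m = 1 := by
  apply Subtype.ext
  rw [coe_node hm le_rfl, div_self (by positivity)]; rfl

lemma node_mono (m : ℕ) : Monotone (node m) := fun i j hij =>
  monotone_projIcc _ (by gcongr)

/-- The index of the partition interval `]i / m, (i + 1) / m]` containing `t`. -/
noncomputable def cell (m : ℕ) (t : I) : ℕ := ⌈(t : ℝ) * m⌉₊ - 1

lemma cell_of_mem {m i : ℕ} (hi : i < m) {t : I} (ht : t ∈ Ioc (node m i) (node m (i + 1))) :
    cell m t = i := by
  have hm : 0 < m := by omega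
  have hm' : (0 : ℝ) < m := by exact_mod_cast hm
  have h1 : (node m i : ℝ) < t := ht.1
  have h2 : (t : ℝ) ≤ node m (i + 1) := ht.2
  rw [coe_node hm hi.le, div_lt_iff₀ hm'] at h1
  rw [coe_node hm hi, le_div_iff₀ hm'] at h2
  have : ⌈(t : ℝ) * m⌉₊ = i + 1 := by
    rw [Nat.ceil_eq_iff (by omega)]
    exact ⟨by simpa using h1, by simpa using h2⟩
  rw [cell, this]; rfl

lemma cell_spec {m : ℕ} (hm : 0 < m) {t : I} (ht : 0 < t) :
    cell m t < m ∧ t ∈ Ioc (node m (cell m t)) (node m (cell m t + 1)) := by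
  have hm' : (0 : ℝ) < m := by exact_mod_cast hm
  have ht' : (0 : ℝ) < t := ht
  have hpos : 0 < ⌈(t : ℝ) * m⌉₊ := Nat.ceil_pos.2 (by positivity)
  have hle : ⌈(t : ℝ) * m⌉₊ ≤ m := Nat.ceil_le.2 (mul_le_of_le_one_left hm'.le t.2.2)
  have hc : cell m t + 1 = ⌈(t : ℝ) * m⌉₊ := by rw [cell]; omega
  have hlt : cell m t < m := by omega
  refine ⟨hlt, ?_, ?_⟩
  · change (node m (cell m t) : ℝ) < t
    rw [coe_node hm hlt.le, div_lt_iff₀ hm']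
    exact Nat.lt_ceil.1 (by omega)
  · change (t : ℝ) ≤ node m (cell m t + 1)
    rw [coe_node hm hlt, le_div_iff₀ hm', Nat.succ_eq_add_one, hc]
    exact Nat.le_ceil _

lemma node_succ_sub {m i : ℕ} (hi : i < m) :
    (node m (i + 1) : ℝ) - node m i = 1 / m := by
  have hm : 0 < m := by omega
  rw [coe_node hm hi, coe_node hm hi.le]
  push_cast; ring

/-- The approach is strictly from the left, so values of `g` tend to the left limit; the right
endpoints may hit `t`, where right continuity suffices. -/
lemma tendsto_node_cell {t : I} (ht : 0 < t) :
    Tendsto (fun m => node m (cell m t)) atTop (𝓝[<] t) := by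
  rw [tendsto_nhdsWithin_iff]
  constructor
  · rw [tendsto_subtype_rng]
    have h1 : Tendsto (fun m : ℕ => (t : ℝ) - 1 / m) atTop (𝓝 (t - 0)) :=
      tendsto_const_nhds.sub tendsto_one_div_atTop_nhds_zero_nat
    rw [sub_zero] at h1
    refine tendsto_of_tendsto_of_tendsto_of_le_of_le' h1 tendsto_const_nhds ?_ ?_
    · filter_upwards [eventually_gt_atTop 0] with m hm
      have h2 := (cell_spec hm ht).2.2
      have h3 : (t : ℝ) ≤ node m (cell m t + 1) := h2
      linarith [node_succ_sub (cell_spec hm ht).1]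
    · filter_upwards [eventually_gt_atTop 0] with m hm
      exact (cell_spec hm ht).2.1.le
  · filter_upwards [eventually_gt_atTop 0] with m hm
    exact (cell_spec hm ht).2.1

lemma tendsto_node_cell_succ {t : I} (ht : 0 < t) :
    Tendsto (fun m => node m (cell m t + 1)) atTop (𝓝[≥] t) := by
  rw [tendsto_nhdsWithin_iff]
  constructor
  · rw [tendsto_subtype_rng]
    have h1 : Tendsto (fun m : ℕ => (t : ℝ) + 1 / m) atTop (𝓝 (t + 0)) :=
      tendsto_const_nhds.add tendsto_one_div_atTop_nhds_zero_nat
    rw [add_zero] at h1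
    refine tendsto_of_tendsto_of_tendsto_of_le_of_le' tendsto_const_nhds h1 ?_ ?_
    · filter_upwards [eventually_gt_atTop 0] with m hm
      exact (cell_spec hm ht).2.2
    · filter_upwards [eventually_gt_atTop 0] with m hm
      have h3 : (node m (cell m t) : ℝ) < t := (cell_spec hm ht).2.1
      linarith [node_succ_sub (cell_spec hm ht).1]
  · filter_upwards [eventually_gt_atTop 0] with m hm
    exact (cell_spec hm ht).2.2

lemma setIntegral_Ioc_eq_sum {x : ℕ → I} (hx : Monotone x) {f : I → ℝ} {c : ℕ → ℝ} (m : ℕ)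
    (hf : ∀ i < m, ∀ y ∈ Ioc (x i) (x (i + 1)), f y = c i) :
    IntegrableOn f (Ioc (x 0) (x m)) ∧
      ∫ y in Ioc (x 0) (x m), f y = ∑ i ∈ Finset.range m, ((x (i + 1) : ℝ) - x i) * c i := by
  induction m with
  | zero => simp
  | succ m ih =>
    obtain ⟨ih1, ih2⟩ := ih fun i hi => hf i (by omega)
    have e : Ioc (x 0) (x (m + 1)) = Ioc (x 0) (x m) ∪ Ioc (x m) (x (m + 1)) :=
      (Ioc_union_Ioc_eq_Ioc (hx (Nat.zero_le _)) (hx (Nat.le_succ _))).symm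
    have hI : IntegrableOn f (Ioc (x m) (x (m + 1))) :=
      (integrableOn_const (C := c m) (by simp)).congr_fun
        (fun y hy => (hf m (by omega) y hy).symm) measurableSet_Ioc
    refine ⟨e ▸ ih1.union hI, ?_⟩
    rw [e, setIntegral_union ?_ measurableSet_Ioc ih1 hI, ih2, Finset.sum_range_succ,
      setIntegral_congr_fun measurableSet_Ioc (hf m (by omega)), setIntegral_const,
      measureReal_def, unitInterval.volume_Ioc, ENNReal.toReal_ofReal, smul_eq_mul]
    · exact sub_nonneg.2 (hx (Nat.le_succ _))
    · rw [Set.disjoint_left]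
      exact fun z hz hz' => hz'.1.not_ge hz.2

lemma integral_eq_sum {x : ℕ → I} (hx : Monotone x) {f : I → ℝ} {c : ℕ → ℝ} {m : ℕ}
    (hf : ∀ i < m, ∀ y ∈ Ioc (x i) (x (i + 1)), f y = c i) (h0 : x 0 = 0) (h1 : x m = 1) :
    AEStronglyMeasurable f (volume : Measure I) ∧
      ∫ y : I, f y = ∑ i ∈ Finset.range m, ((x (i + 1) : ℝ) - x i) * c i := by
  obtain ⟨h2, h3⟩ := setIntegral_Ioc_eq_sum hx m hf
  have hr : (volume : Measure I).restrict (Ioc (x 0) (x m)) = volume := by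
    refine Measure.restrict_eq_self_of_ae_mem ?_
    filter_upwards [(countable_singleton (0 : I)).ae_notMem volume] with y hy
    rw [h0, h1]
    exact ⟨lt_of_le_of_ne y.2.1 (fun e => hy e.symm), y.2.2⟩
  rw [IntegrableOn, hr] at h2
  rw [hr] at h3
  exact ⟨h2.aestronglyMeasurable, h3⟩

/-- Riemann sums with values read off at the endpoints of the partition intervals, after a
substitution `ρ`. -/
lemma tendsto_sum_of_continuous (g : G0) {Ψ : I × I → ℝ} (hΨ : Continuous Ψ) {ρ : I → I}
    (hρ : ∀ᵐ y, 0 < ρ y) {x : ℕ → ℕ → I} (hx : ∀ m, Monotone (x m)) (hx0 : ∀ m, x m 0 = 0)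
    (hx1 : ∀ m, 0 < m → x m m = 1)
    (hxρ : ∀ m, ∀ i < m, ∀ y ∈ Ioc (x m i) (x m (i + 1)), ρ y ∈ Ioc (node m i) (node m (i + 1))) :
    Tendsto (fun m => ∑ i ∈ Finset.range m,
        ((x m (i + 1) : ℝ) - x m i) * Ψ (g (node m i), g (node m (i + 1)))) atTop
      (𝓝 (∫ y : I, Ψ (Function.leftLim g (ρ y), g (ρ y)))) := by
  obtain ⟨C, hC⟩ := (isCompact_range hΨ).isBounded.exists_norm_le
  -- The shift to `m + 1` avoids the empty partition, whose last point is not 1.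
  set F : ℕ → I → ℝ := fun m y => Ψ (g (node (m + 1) (cell (m + 1) (ρ y))),
    g (node (m + 1) (cell (m + 1) (ρ y) + 1)))
  have key : ∀ m, AEStronglyMeasurable (F m) (volume : Measure I) ∧ ∫ y : I, F m y =
      ∑ i ∈ Finset.range (m + 1), ((x (m + 1) (i + 1) : ℝ) - x (m + 1) i) *
        Ψ (g (node (m + 1) i), g (node (m + 1) (i + 1))) := fun m =>
    integral_eq_sum (hx (m + 1))
      (c := fun i => Ψ (g (node (m + 1) i), g (node (m + 1) (i + 1))))
      (fun i hi y hy => by simp only [F]; rw [cell_of_mem hi (hxρ _ i hi y hy)])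
      (hx0 _) (hx1 _ (Nat.succ_pos _))
  rw [← tendsto_add_atTop_iff_nat 1]
  simp only [← (key _).2]
  refine tendsto_integral_of_dominated_convergence (fun _ => C) (fun m => (key m).1)
    (integrable_const _) (fun m => Eventually.of_forall fun y => hC _ ⟨_, rfl⟩) ?_
  filter_upwards [hρ] with y hy
  have h1 : Tendsto (fun m => g (node m (cell m (ρ y)))) atTop (𝓝 (Function.leftLim g (ρ y))) :=
    (g.monotone'.tendsto_leftLim (ρ y)).comp (tendsto_node_cell hy)
  have h2 : Tendsto (fun m => g (node m (cell m (ρ y) + 1))) atTop (𝓝 (g (ρ y))) :=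
    (g.rightCts' (ρ y)).tendsto.comp (tendsto_node_cell_succ hy)
  exact ((hΨ.tendsto _).comp (h1.prodMk_nhds h2)).comp (tendsto_add_atTop_nat 1)

end Partition

/-! ### The left continuous inverse -/

section Inverse

/-- The left continuous inverse of `g`. -/
noncomputable def leftInv (g : G0) (y : I) : I := sInf {t | y ≤ g t}

/-- By right continuity of `g`, the infimum is attained. -/
lemma le_apply_leftInv (g : G0) (y : I) : y ≤ g (leftInv g y) := by
  by_contra hlt
  rw [not_le] at hlt
  have h1 := (isGLB_sInf {t | y ≤ g t}).frequently_mem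
    ⟨1, show y ≤ g 1 by rw [g.map_one']; exact y.2.2⟩
  have h2 := (g.rightCts' (leftInv g y)).tendsto.eventually (eventually_lt_nhds hlt)
  obtain ⟨t, ht, ht'⟩ := (h1.and_eventually h2).exists
  exact ht'.not_ge ht

/-- This Galois connection sends `Ioc (g s) (g t)` into `Ioc s t`, as `tendsto_sum_of_continuous`
requires of a substitution. -/
lemma leftInv_le_iff (g : G0) {y t : I} : leftInv g y ≤ t ↔ y ≤ g t :=
  ⟨fun h1 => (le_apply_leftInv g y).trans (g.monotone' h1), fun h1 => sInf_le h1⟩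

lemma lt_leftInv_iff (g : G0) {y t : I} : t < leftInv g y ↔ g t < y := by
  rw [← not_le, leftInv_le_iff, not_le]

lemma leftLim_leftInv_le (g : G0) {y : I} (hy : 0 < leftInv g y) :
    Function.leftLim g (leftInv g y) ≤ y := by
  have : (𝓝[<] leftInv g y).NeBot := nhdsLT_neBot_of_exists_lt ⟨0, hy⟩
  refine le_of_tendsto (g.monotone'.tendsto_leftLim _) ?_
  filter_upwards [self_mem_nhdsWithin] with t ht
  exact ((lt_leftInv_iff g).1 ht).le

lemma leftInv_mono (g : G0) : Monotone (leftInv g) := fun _ y hxy =>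
  (leftInv_le_iff g).2 (hxy.trans (le_apply_leftInv g y))

lemma leftInv_of_mem_Ioo (g : G0) {a y : I} (hy : y ∈ Ioo (Function.leftLim g a) (g a)) :
    leftInv g y = a := by
  refine le_antisymm ((leftInv_le_iff g).2 hy.2.le) (le_of_not_gt fun hlt => ?_)
  exact ((le_apply_leftInv g y).trans (g.monotone'.le_leftLim hlt)).not_gt hy.1

lemma countable_jumps (g : G0) : (jumps g).Countable := by
  refine g.monotone'.countable_not_continuousAt.mono ?_
  intro a ha hc
  exact ha.2.2.ne (ContinuousWithinAt.leftLim_eq hc.continuousWithinAt)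

/-- On the interval spanned by a jump at `a` the integrand is constant, as `leftInv g` equals `a`
there. Almost everywhere else `g` has no jump at `leftInv g y`, and the integrand is a diagonal
value. -/
lemma integral_comp_leftInv (g : G0) (h0 : g 0 = 0) (h1 : Function.leftLim g 1 = 1)
    {Ψ : I × I → ℝ} (hΨ : Continuous Ψ) (hdiag : ∀ x, Ψ (x, x) = 0) :
    ∫ y : I, Ψ (Function.leftLim g (leftInv g y), g (leftInv g y)) =
      ∑' a : jumps g, ((g a : ℝ) - Function.leftLim g a) * Ψ (Function.leftLim g a, g a) := by
  set f : I → ℝ := fun y => Ψ (Function.leftLim g (leftInv g y), g (leftInv g y)) with hf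
  have hfm : Measurable f :=
    hΨ.measurable.comp ((g.monotone'.leftLim.measurable.comp (leftInv_mono g).measurable).prodMk
      (g.monotone'.measurable.comp (leftInv_mono g).measurable))
  obtain ⟨C, hC⟩ := (isCompact_range hΨ).isBounded.exists_norm_le
  have hfi : Integrable f (volume : Measure I) :=
    Integrable.of_bound hfm.aestronglyMeasurable C
      (Eventually.of_forall fun y => hC _ ⟨_, rfl⟩)
  have := (countable_jumps g).to_subtype
  have hU : ∫ y : I, f y = ∫ y in ⋃ a : jumps g, Ioo (Function.leftLim g a) (g a), f y := by
    rw [← setIntegral_univ]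
    refine setIntegral_eq_of_subset_of_ae_sdiff_eq_zero nullMeasurableSet_univ (subset_univ _) ?_
    have c1 : (Function.leftLim g '' jumps g).Countable := (countable_jumps g).image _
    have c2 : (g '' jumps g).Countable := (countable_jumps g).image _
    -- The discarded points are the countably many endpoints of jump intervals, together with 0 and
    -- 1; excluding the latter puts `leftInv g y` strictly inside the interval, by `h0` and `h1`.
    filter_upwards [c1.ae_notMem volume, c2.ae_notMem volume,
      (countable_singleton (0 : I)).ae_notMem volume,
      (countable_singleton (1 : I)).ae_notMem volume] with y y1 y2 y3 y4 hy
    have hpos : 0 < leftInv g y := by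
      rw [lt_leftInv_iff, h0]
      exact lt_of_le_of_ne y.2.1 fun e => y3 e.symm
    have hle := leftLim_leftInv_le g hpos
    have hlt : leftInv g y < 1 := by
      refine lt_of_le_of_ne (leftInv g y).2.2 fun e => y4 ?_
      rw [e, h1] at hle
      exact le_antisymm y.2.2 hle
    have heq : Function.leftLim g (leftInv g y) = g (leftInv g y) := by
      refine le_antisymm (g.monotone'.leftLim_le le_rfl) (le_of_not_gt fun hj => ?_)
      have hmem : leftInv g y ∈ jumps g := ⟨hpos, hlt, hj⟩
      refine hy.2 (mem_iUnion.2 ⟨⟨_, hmem⟩, lt_of_le_of_ne hle ?_,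
        lt_of_le_of_ne (le_apply_leftInv g y) ?_⟩)
      · exact fun e => y1 ⟨_, hmem, e⟩
      · exact fun e => y2 ⟨_, hmem, e.symm⟩
    simp only [hf]
    rw [heq, hdiag]
  have hS := hasSum_integral_iUnion (f := f) (μ := (volume : Measure I))
    (s := fun a : jumps g => Ioo (Function.leftLim g a) (g a)) (fun _ => measurableSet_Ioo)
    (pairwise_disjoint_jumps g) hfi.integrableOn
  rw [hU, ← hS.tsum_eq]
  refine tsum_congr fun a => ?_
  rw [setIntegral_congr_fun (g := fun _ => Ψ (Function.leftLim g a, g a)) measurableSet_Ioo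
    (fun y hy => by simp only [hf]; rw [leftInv_of_mem_Ioo g hy]), setIntegral_const,
    measureReal_def, unitInterval.volume_Ioo, ENNReal.toReal_ofReal, smul_eq_mul]
  exact sub_nonneg.2 (jumps_lt g a).le

end Inverse

/-! ### Convergence and uniform bounds of the approximate densities -/

section Limit

variable {h : I ≃o I}

/-- The approximation of `Y` along the partition into `m` intervals of equal length. -/
noncomputable def YApprox (β : ℝ) (h : I ≃o I) (m : ℕ) (g : G0) : ℝ :=
  1 / √(dh h 0 * dh h 1) * Real.exp
    (β * (∑ i ∈ Finset.range m, ((node m (i + 1) : ℝ) - node m i) *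
      Real.log (slopeI h (g (node m i)) (g (node m (i + 1))))) +
    ∑ i ∈ Finset.range m, ((g (node m (i + 1)) : ℝ) - g (node m i)) *
      logJumpRate h (g (node m i)) (g (node m (i + 1))))

lemma IsC2Iso.continuous_log_slopeI (hh : IsC2Iso h) :
    Continuous fun p : I × I => Real.log (slopeI h p.1 p.2) :=
  hh.continuous_slopeI.log fun p => (hh.slopeI_pos p.1 p.2).ne'

lemma ae_pos : ∀ᵐ y : I, 0 < y := by
  filter_upwards [(countable_singleton (0 : I)).ae_notMem volume] with y hy
  exact lt_of_le_of_ne y.2.1 fun e => hy e.symm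

/-- Two Riemann sums: one in the time variable (`ρ = id`), giving the exponent of `X`, and one in
the range of `g` (`ρ = leftInv g`), giving the jumps. -/
lemma IsC2Iso.tendsto_YApprox (hh : IsC2Iso h) (β : ℝ) (g : G0) (h0 : g 0 = 0)
    (h1 : Function.leftLim g 1 = 1) :
    Tendsto (fun m => YApprox β h m g) atTop (𝓝 (Y β h g)) := by
  have t1 := tendsto_sum_of_continuous g hh.continuous_log_slopeI (ρ := id) (x := node)
    ae_pos node_mono node_zero (fun m hm => node_self hm) (fun m i hi y hy => hy)
  have t2 := tendsto_sum_of_continuous g hh.continuous_logJumpRate (ρ := leftInv g)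
    (x := fun m i => g (node m i)) ?_ (fun m => g.monotone'.comp (node_mono m))
    (fun m => by simp only [node_zero, h0]) (fun m hm => by simp only [node_self hm, g.map_one'])
    (fun m i hi y hy => ⟨(lt_leftInv_iff g).2 hy.1, (leftInv_le_iff g).2 hy.2⟩)
  · have e1 : ∫ y : I, Real.log (slopeI h (Function.leftLim g (id y)) (g (id y))) =
        ∫ y : I, Real.log (dh h (g y)) := by
      refine integral_congr_ae ?_
      filter_upwards [g.monotone'.countable_not_continuousAt.ae_notMem volume] with y hy
      have hc : ContinuousAt g y := by simpa using hy
      rw [id, ContinuousWithinAt.leftLim_eq hc.continuousWithinAt, slopeI_self]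
    rw [e1] at t1
    rw [integral_comp_leftInv g h0 h1 hh.continuous_logJumpRate (logJumpRate_self h)] at t2
    rw [hh.Y_eq]
    exact ((Real.continuous_exp.tendsto _).comp ((t1.const_mul β).add t2)).const_mul _
  · filter_upwards [ae_pos] with y hy
    rwa [lt_leftInv_iff, h0]

lemma IsC2Iso.exists_YApprox_bound (hh : IsC2Iso h) (β : ℝ) :
    ∃ C : ℝ, ∀ m, ∀ g : G0, |YApprox β h m g| ≤ C := by
  obtain ⟨K, hK0, hK⟩ := hh.exists_abs_logJumpRate_le_forall
  obtain ⟨L, hL⟩ := (isCompact_range hh.continuous_log_slopeI).isBounded.exists_norm_le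
  have hL0 : 0 ≤ L := (norm_nonneg _).trans (hL _ ⟨(0, 0), rfl⟩)
  have hs : 0 ≤ 1 / √(dh h 0 * dh h 1) := by positivity
  -- The weights are nonnegative and telescope to at most 1.
  have key : ∀ (x : ℕ → I) (hx : Monotone x) (c : ℕ → ℝ) (B : ℝ) (_ : 0 ≤ B)
      (_ : ∀ i, |c i| ≤ B) (m : ℕ),
      |∑ i ∈ Finset.range m, ((x (i + 1) : ℝ) - x i) * c i| ≤ B := by
    intro x hx c B hB hc m
    have hx' : ∀ i, 0 ≤ (x (i + 1) : ℝ) - x i := fun i => sub_nonneg.2 (hx (Nat.le_succ i))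
    calc _ ≤ ∑ i ∈ Finset.range m, |((x (i + 1) : ℝ) - x i) * c i| :=
          Finset.abs_sum_le_sum_abs _ _
      _ ≤ ∑ i ∈ Finset.range m, ((x (i + 1) : ℝ) - x i) * B := by
          refine Finset.sum_le_sum fun i _ => ?_
          rw [abs_mul, abs_of_nonneg (hx' i)]
          exact mul_le_mul_of_nonneg_left (hc i) (hx' i)
      _ = ((x m : ℝ) - x 0) * B := by
          rw [← Finset.sum_mul, Finset.sum_range_sub (fun i => (x i : ℝ))]
      _ ≤ B := mul_le_of_le_one_left hB (by linarith [(x m).2.2, (x 0).2.1])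
  refine ⟨1 / √(dh h 0 * dh h 1) * Real.exp (|β| * L + K), fun m g => ?_⟩
  rw [YApprox, abs_mul, abs_of_nonneg hs, Real.abs_exp]
  refine mul_le_mul_of_nonneg_left (Real.exp_le_exp.2 (add_le_add ?_ ?_)) hs
  · refine (le_abs_self _).trans ?_
    rw [abs_mul]
    exact mul_le_mul_of_nonneg_left (key (node m) (node_mono m)
      (fun i => Real.log (slopeI h (g (node m i)) (g (node m (i + 1))))) L hL0
      (fun i => hL _ ⟨(_, _), rfl⟩) m) (abs_nonneg _)
  · exact (le_abs_self _).trans (key (fun i => g (node m i)) (g.monotone'.comp (node_mono m))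
      (fun i => logJumpRate h (g (node m i)) (g (node m (i + 1)))) K hK0 (fun i => hK _ _) m)

end Limit

/-! ### The Dirichlet distribution under a change of variables -/

section Dirichlet

variable {h : I ≃o I} {N : ℕ}

lemma withEnds_zero (x : Fin N → ℝ) : withEnds x 0 = 0 := rfl

lemma withEnds_last (x : Fin N → ℝ) : withEnds x (Fin.last (N + 1)) = 1 := by
  rw [← Fin.succ_last, withEnds, Fin.cons_succ, Fin.snoc_last]

lemma withEnds_castSucc_succ (x : Fin N → ℝ) (i : Fin N) : withEnds x i.castSucc.succ = x i := by
  rw [withEnds, Fin.cons_succ, Fin.snoc_castSucc]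

lemma withEnds_forall {P : Fin (N + 2) → Prop} (h0 : P 0) (h1 : P (Fin.last (N + 1)))
    (hi : ∀ i : Fin N, P i.castSucc.succ) (j : Fin (N + 2)) : P j := by
  refine Fin.cases h0 (fun i => ?_) j
  refine Fin.lastCases ?_ (fun i => hi i) i
  rwa [Fin.succ_last]

lemma withEnds_comp {f : ℝ → ℝ} (h0 : f 0 = 0) (h1 : f 1 = 1) (x : Fin N → ℝ) (j : Fin (N + 2)) :
    withEnds (fun i => f (x i)) j = f (withEnds x j) := by
  refine withEnds_forall (P := fun j => withEnds (fun i => f (x i)) j = f (withEnds x j))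
    ?_ ?_ (fun i => ?_) j
  · rw [withEnds_zero, withEnds_zero, h0]
  · rw [withEnds_last, withEnds_last, h1]
  · rw [withEnds_castSucc_succ, withEnds_castSucc_succ]

lemma withEnds_nat {f : ℕ → ℝ} (h0 : f 0 = 0) (h1 : f (N + 1) = 1) (j : Fin (N + 2)) :
    withEnds (fun i : Fin N => f (i + 1)) j = f j := by
  refine withEnds_forall (P := fun j => withEnds (fun i : Fin N => f (i + 1)) j = f j)
    ?_ ?_ (fun i => ?_) j
  · rw [withEnds_zero, Fin.val_zero, h0]
  · rw [withEnds_last, Fin.val_last, h1]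
  · rw [withEnds_castSucc_succ]; simp

lemma continuous_withEnds (j : Fin (N + 2)) : Continuous fun x : Fin N → ℝ => withEnds x j := by
  refine withEnds_forall (P := fun j => Continuous fun x : Fin N → ℝ => withEnds x j)
    ?_ ?_ (fun i => ?_) j
  · simp only [withEnds_zero]; fun_prop
  · simp only [withEnds_last]; fun_prop
  · simp only [withEnds_castSucc_succ]; fun_prop

/-- The open simplex `0 < x_1 < ⋯ < x_N < 1`. -/
def openSimplex (N : ℕ) : Set (Fin N → ℝ) := {x | StrictMono (withEnds x)}

lemma isOpen_openSimplex : IsOpen (openSimplex N) := by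
  have : openSimplex N = ⋂ i : Fin (N + 1), {x | withEnds x i.castSucc < withEnds x i.succ} := by
    ext x
    simp only [mem_iInter]
    exact Fin.strictMono_iff_lt_succ
  rw [this]
  exact isOpen_iInter_of_finite fun i => isOpen_lt (continuous_withEnds _) (continuous_withEnds _)

lemma withEnds_mem {x : Fin N → ℝ} (hx : x ∈ openSimplex N) (j : Fin (N + 2)) :
    withEnds x j ∈ Icc (0 : ℝ) 1 := by
  have hx' : StrictMono (withEnds x) := hx
  exact ⟨(withEnds_zero x).symm.trans_le (hx'.monotone (Fin.zero_le j)),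
    (hx'.monotone (Fin.le_last j)).trans_eq (withEnds_last x)⟩

lemma mem_Ioo_of_mem_openSimplex {x : Fin N → ℝ} (hx : x ∈ openSimplex N) (i : Fin N) :
    x i ∈ Ioo (0 : ℝ) 1 := by
  have hx' : StrictMono (withEnds x) := hx
  rw [← withEnds_castSucc_succ x i]
  exact ⟨(withEnds_zero x).symm.trans_lt (hx' (Fin.succ_pos _)),
    (hx' (by rw [← Fin.succ_last, Fin.succ_lt_succ_iff]; exact Fin.castSucc_lt_last i)).trans_eq
      (withEnds_last x)⟩

lemma measurable_dirichletDensity (β : ℝ) (t : Fin N → ℝ) :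
    Measurable (dirichletDensity β t) := by
  unfold dirichletDensity
  refine Measurable.ite isOpen_openSimplex.measurableSet ?_ measurable_const
  refine measurable_const.mul (Finset.measurable_fun_prod _ fun i _ => ?_)
  exact ((continuous_withEnds _).measurable.sub (continuous_withEnds _).measurable).pow_const _

/-- The Dirichlet distribution with parameters `β (t_{i+1} - t_i)`. -/
noncomputable def dirichletMeasure (β : ℝ) (t : Fin N → ℝ) : Measure (Fin N → ℝ) :=
  volume.withDensity fun x => ENNReal.ofReal (dirichletDensity β t x)

/-- The density of the image of the Dirichlet distribution under `h⁻¹` in each coordinate. -/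
noncomputable def dirichletRatio (β : ℝ) (h : I ≃o I) (t x : Fin N → ℝ) : ℝ :=
  (∏ i, dh h (projIcc 0 1 zero_le_one (x i))) *
    ∏ i : Fin (N + 1), slopeI h (projIcc 0 1 zero_le_one (withEnds x i.castSucc))
      (projIcc 0 1 zero_le_one (withEnds x i.succ)) ^
        (β * (withEnds t i.succ - withEnds t i.castSucc) - 1)

lemma IsC2Iso.measurable_dirichletRatio (hh : IsC2Iso h) (β : ℝ) (t : Fin N → ℝ) :
    Measurable (dirichletRatio β h t) := by
  unfold dirichletRatio
  refine Measurable.mul (Finset.measurable_fun_prod _ fun i _ => ?_)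
    (Finset.measurable_fun_prod _ fun i _ => ?_)
  · exact (hh.continuous_dh_projIcc.comp (continuous_apply i)).measurable
  · refine Measurable.pow_const ?_ _
    have hp : Continuous (projIcc (0 : ℝ) 1 zero_le_one) := continuous_projIcc
    exact (hh.continuous_slopeI.comp ((hp.comp (continuous_withEnds i.castSucc)).prodMk
      (hp.comp (continuous_withEnds i.succ)))).measurable

lemma IsC2Iso.dirichletRatio_nonneg (hh : IsC2Iso h) (β : ℝ) (t x : Fin N → ℝ) :
    0 ≤ dirichletRatio β h t x :=
  mul_nonneg (Finset.prod_nonneg fun _ _ => (hh.dh_pos _).le)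
    (Finset.prod_nonneg fun _ _ => Real.rpow_nonneg (hh.slopeI_pos _ _).le _)

lemma extFun_zero (h : I ≃o I) : extFun h 0 = 0 := by
  have h1 := extFun_apply h 0
  have h2 : h 0 = 0 := h.map_bot
  rwa [h2] at h1

lemma extFun_one (h : I ≃o I) : extFun h 1 = 1 := by
  have h1 := extFun_apply h 1
  have h2 : h 1 = 1 := h.map_top
  rwa [h2] at h1

lemma continuous_extFun (h : I ≃o I) : Continuous (extFun h) :=
  continuous_subtype_val.comp (h.continuous.comp continuous_projIcc)

lemma extFun_symm_extFun (h : I ≃o I) {x : ℝ} (hx : x ∈ Icc (0 : ℝ) 1) :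
    extFun h.symm (extFun h x) = x := by
  rw [extFun_of_mem h hx, extFun_apply]; simp

lemma extFun_mem_openSimplex (h : I ≃o I) {x : Fin N → ℝ} (hx : x ∈ openSimplex N) :
    (fun i => extFun h (x i)) ∈ openSimplex N := by
  intro i j hij
  rw [withEnds_comp (extFun_zero h) (extFun_one h), withEnds_comp (extFun_zero h) (extFun_one h),
    extFun_of_mem h (withEnds_mem hx i), extFun_of_mem h (withEnds_mem hx j)]
  exact h.strictMono (show (⟨withEnds x i, withEnds_mem hx i⟩ : I) < ⟨withEnds x j, _⟩ from hx hij)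

/-- Increments of `h` are slopes times increments of `x`; the Gamma factors depend only on `t` and
are unaffected. -/
lemma IsC2Iso.dirichletDensity_extFun (hh : IsC2Iso h) (β : ℝ) (t : Fin N → ℝ) {x : Fin N → ℝ}
    (hx : x ∈ openSimplex N) :
    (∏ i, dh h (projIcc 0 1 zero_le_one (x i))) * dirichletDensity β t (fun i => extFun h (x i)) =
      dirichletDensity β t x * dirichletRatio β h t x := by
  have hx1 : StrictMono (withEnds x) := hx
  have hx2 : StrictMono (withEnds fun i => extFun h (x i)) := extFun_mem_openSimplex h hx
  rw [dirichletDensity, dirichletDensity, if_pos hx1, if_pos hx2, dirichletRatio]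
  have key : ∀ i : Fin (N + 1),
      (withEnds (fun i => extFun h (x i)) i.succ - withEnds (fun i => extFun h (x i)) i.castSucc) ^
        (β * (withEnds t i.succ - withEnds t i.castSucc) - 1) =
      (withEnds x i.succ - withEnds x i.castSucc) ^
        (β * (withEnds t i.succ - withEnds t i.castSucc) - 1) *
      slopeI h (projIcc 0 1 zero_le_one (withEnds x i.castSucc))
        (projIcc 0 1 zero_le_one (withEnds x i.succ)) ^
          (β * (withEnds t i.succ - withEnds t i.castSucc) - 1) := by
    intro i
    have hlt : withEnds x i.castSucc < withEnds x i.succ := hx1 i.castSucc_lt_succ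
    rw [withEnds_comp (extFun_zero h) (extFun_one h), withEnds_comp (extFun_zero h) (extFun_one h),
      extFun_of_mem h (withEnds_mem hx _), extFun_of_mem h (withEnds_mem hx _),
      projIcc_of_mem _ (withEnds_mem hx _), projIcc_of_mem _ (withEnds_mem hx _),
      ← Real.mul_rpow (sub_nonneg.2 hlt.le) (hh.slopeI_pos _ _).le,
      ← hh.slopeI_mul (x := ⟨withEnds x i.castSucc, withEnds_mem hx _⟩)
        (y := ⟨withEnds x i.succ, withEnds_mem hx _⟩) hlt.le]
  rw [Finset.prod_congr rfl fun i _ => key i, Finset.prod_mul_distrib]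
  ring

lemma IsC2Iso.hasFDerivAt_extFun_pi (hh : IsC2Iso h) {x : Fin N → ℝ} (hx : x ∈ openSimplex N) :
    HasFDerivAt (fun (x : Fin N → ℝ) i => extFun h (x i))
      (ContinuousLinearMap.pi fun i => (dh h (projIcc 0 1 zero_le_one (x i)) •
        ContinuousLinearMap.id ℝ ℝ).comp (ContinuousLinearMap.proj i)) x := by
  rw [hasFDerivAt_pi]
  intro i
  have hi := mem_Ioo_of_mem_openSimplex hx i
  have h1 := (hh.hasDerivWithinAt ⟨x i, Ioo_subset_Icc_self hi⟩).hasDerivAt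
    (Icc_mem_nhds hi.1 hi.2)
  rw [projIcc_of_mem _ (Ioo_subset_Icc_self hi)]
  have h2 := h1.hasFDerivAt.comp x (ContinuousLinearMap.proj (R := ℝ) (φ := fun _ => ℝ) i).hasFDerivAt
  exact h2.congr_fderiv (by ext; simp [mul_comm])

lemma det_pi_smul_proj (c : Fin N → ℝ) :
    (ContinuousLinearMap.pi fun i => (c i • ContinuousLinearMap.id ℝ ℝ).comp
      (ContinuousLinearMap.proj (R := ℝ) (φ := fun _ : Fin N => ℝ) i)).det = ∏ i, c i := by
  rw [ContinuousLinearMap.det_pi]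
  simp [ContinuousLinearMap.det]

/-- Change of variables on the open simplex. The maps are clamped outside `[0,1]` and invertible
only inside, but the density lives on the simplex. -/
lemma IsC2Iso.map_dirichletMeasure (hh : IsC2Iso h) (β : ℝ) (t : Fin N → ℝ) :
    (dirichletMeasure β t).map (fun x i => extFun h.symm (x i)) =
      (dirichletMeasure β t).withDensity
        (fun x => ENNReal.ofReal (dirichletRatio β h t x)) := by
  set K : (Fin N → ℝ) → (Fin N → ℝ) := fun x i => extFun h.symm (x i)
  set H : (Fin N → ℝ) → (Fin N → ℝ) := fun x i => extFun h (x i)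
  have hK : Measurable K :=
    measurable_pi_lambda _ fun i => ((continuous_extFun h.symm).comp (continuous_apply i)).measurable
  have hS : MeasurableSet (openSimplex N) := isOpen_openSimplex.measurableSet
  have hd : Measurable fun x => ENNReal.ofReal (dirichletDensity β t x) :=
    (measurable_dirichletDensity β t).ennreal_ofReal
  have hR : Measurable fun x => ENNReal.ofReal (dirichletRatio β h t x) :=
    (hh.measurable_dirichletRatio β t).ennreal_ofReal
  have hzero : ∀ x ∉ openSimplex N, dirichletDensity β t x = 0 := fun x hx => if_neg hx
  have hKH : ∀ x ∈ openSimplex N, K (H x) = x := fun x hx =>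
    funext fun i => extFun_symm_extFun h (Ioo_subset_Icc_self (mem_Ioo_of_mem_openSimplex hx i))
  have hHK : ∀ x ∈ openSimplex N, H (K x) = x := fun x hx => by
    funext i
    have := extFun_symm_extFun h.symm (Ioo_subset_Icc_self (mem_Ioo_of_mem_openSimplex hx i))
    simpa using this
  have restr : ∀ (A : Set (Fin N → ℝ)) (f : (Fin N → ℝ) → ENNReal), MeasurableSet A →
      (∀ x ∉ openSimplex N, f x = 0) →
      ∫⁻ x in A, f x = ∫⁻ x in A ∩ openSimplex N, f x := by
    intro A f hA hf
    rw [← lintegral_indicator hA, ← lintegral_indicator (hA.inter hS)]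
    refine lintegral_congr fun x => ?_
    by_cases hx : x ∈ openSimplex N <;> by_cases hx' : x ∈ A <;> simp [indicator, hx, hx', hf]
  ext B hB
  have himg : H '' (B ∩ openSimplex N) = K ⁻¹' B ∩ openSimplex N := by
    ext y
    constructor
    · rintro ⟨x, ⟨hxB, hxS⟩, rfl⟩
      exact ⟨by rw [mem_preimage, hKH x hxS]; exact hxB, extFun_mem_openSimplex h hxS⟩
    · rintro ⟨hyB, hyS⟩
      exact ⟨K y, ⟨hyB, extFun_mem_openSimplex h.symm hyS⟩, hHK y hyS⟩
  rw [Measure.map_apply hK hB, dirichletMeasure, withDensity_apply _ (hK hB),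
    withDensity_apply _ hB, restrict_withDensity hB,
    lintegral_withDensity_eq_lintegral_mul _ hd hR,
    restr _ _ (hK hB) (fun x hx => by rw [hzero x hx, ENNReal.ofReal_zero]),
    restr _ _ hB (fun x hx => by rw [Pi.mul_apply, hzero x hx, ENNReal.ofReal_zero, zero_mul]),
    ← himg, lintegral_image_eq_lintegral_abs_det_fderiv_mul volume (hB.inter hS)
      (fun x hx => (hh.hasFDerivAt_extFun_pi hx.2).hasFDerivWithinAt)
      (fun x hx y hy hxy => by rw [← hKH x hx.2, ← hKH y hy.2]; exact congrArg K hxy)]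
  refine setLIntegral_congr_fun (hB.inter hS) fun x hx => ?_
  have hp : 0 ≤ ∏ i, dh h (projIcc 0 1 zero_le_one (x i)) :=
    Finset.prod_nonneg fun _ _ => (hh.dh_pos _).le
  simp only [Pi.mul_apply]
  rw [det_pi_smul_proj, abs_of_nonneg hp, ← ENNReal.ofReal_mul hp,
    hh.dirichletDensity_extFun β t hx.2, ENNReal.ofReal_mul' (hh.dirichletRatio_nonneg β t x)]

/-- Interior terms occur in two neighbouring factors, end terms in one; this is the origin of
`√(h'(0) h'(1))`. -/
lemma prod_sqrt_mul_succ {c : ℕ → ℝ} (hc : ∀ i, 0 < c i) (n : ℕ) :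
    ∏ i ∈ Finset.range (n + 1), √(c i * c (i + 1)) =
      √(c 0 * c (n + 1)) * ∏ i ∈ Finset.range n, c (i + 1) := by
  induction n with
  | zero => simp
  | succ n ih =>
    rw [Finset.prod_range_succ, ih, Finset.prod_range_succ _ n, Real.sqrt_mul (hc _).le,
      Real.sqrt_mul (hc _).le, Real.sqrt_mul (hc _).le]
    have : √(c (n + 1)) * √(c (n + 1)) = c (n + 1) := Real.mul_self_sqrt (hc _).le
    linear_combination (√(c 0) * √(c (n + 1 + 1)) * ∏ i ∈ Finset.range n, c (i + 1)) * this

/-- The values of `g` at the interior points of the partition into `N + 1` intervals. -/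
noncomputable def nodeValues (N : ℕ) (g : G0) : Fin N → ℝ := fun i => g (node (N + 1) (i + 1))

lemma IsC2Iso.dirichletRatio_nodeValues (hh : IsC2Iso h) (β : ℝ) (g : G0) (h0 : g 0 = 0) :
    dirichletRatio β h (fun i : Fin N => (node (N + 1) (i + 1) : ℝ)) (nodeValues N g) =
      YApprox β h (N + 1) g := by
  set c : ℕ → ℝ := fun i => dh h (g (node (N + 1) i)) with hc
  have hc0 : ∀ i, 0 < c i := fun i => hh.dh_pos _
  set s : ℕ → ℝ := fun i => slopeI h (g (node (N + 1) i)) (g (node (N + 1) (i + 1))) with hs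
  have hs0 : ∀ i, 0 < s i := fun i => hh.slopeI_pos _ _
  have e1 : ∀ j, withEnds (nodeValues N g) j = g (node (N + 1) j) :=
    withEnds_nat (f := fun i => (g (node (N + 1) i) : ℝ)) (by simp [node_zero, h0])
      (by simp [node_self, g.map_one'])
  have e2 : ∀ j, withEnds (fun i : Fin N => (node (N + 1) (i + 1) : ℝ)) j = node (N + 1) j :=
    withEnds_nat (f := fun i => (node (N + 1) i : ℝ)) (by simp [node_zero]) (by simp [node_self])
  have e3 : dirichletRatio β h (fun i : Fin N => (node (N + 1) (i + 1) : ℝ)) (nodeValues N g) =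
      (∏ i ∈ Finset.range N, c (i + 1)) * ∏ i ∈ Finset.range (N + 1),
        s i ^ (β * ((node (N + 1) (i + 1) : ℝ) - node (N + 1) i) - 1) := by
    rw [dirichletRatio, ← Fin.prod_univ_eq_prod_range (fun i => c (i + 1)),
      ← Fin.prod_univ_eq_prod_range
        (fun i => s i ^ (β * ((node (N + 1) (i + 1) : ℝ) - node (N + 1) i) - 1))]
    congr 1
    · refine Finset.prod_congr rfl fun i _ => ?_
      rw [nodeValues, projIcc_val]
    · refine Finset.prod_congr rfl fun i _ => ?_
      rw [e1, e1, e2, e2, projIcc_val, projIcc_val]; rfl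
  rw [e3, YApprox, Real.exp_add, Finset.mul_sum, Real.exp_sum, Real.exp_sum]
  -- The part `β Δt` of the exponent feeds the Riemann sum of `log` slopes; the `-1` supplies the
  -- denominator of the jump factor.
  have e4 : ∀ i ∈ Finset.range (N + 1),
      s i ^ (β * ((node (N + 1) (i + 1) : ℝ) - node (N + 1) i) - 1) =
      Real.exp (β * (((node (N + 1) (i + 1) : ℝ) - node (N + 1) i) * Real.log (s i))) / s i := by
    intro i _
    rw [Real.rpow_sub (hs0 i), Real.rpow_one, Real.rpow_def_of_pos (hs0 i)]
    congr 2; ring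
  have e5 : ∀ i ∈ Finset.range (N + 1),
      Real.exp (((g (node (N + 1) (i + 1)) : ℝ) - g (node (N + 1) i)) *
        logJumpRate h (g (node (N + 1) i)) (g (node (N + 1) (i + 1)))) =
      √(c i * c (i + 1)) / s i := fun i _ => by rw [hh.exp_logJumpRate]; rfl
  rw [Finset.prod_congr rfl e4, Finset.prod_congr rfl e5, Finset.prod_div_distrib,
    Finset.prod_div_distrib, prod_sqrt_mul_succ hc0]
  have e6 : dh h 0 = c 0 := by simp only [hc, node_zero, h0]
  have e7 : dh h 1 = c (N + 1) := by simp only [hc, node_self (Nat.succ_pos N), g.map_one']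
  rw [e6, e7]
  have e8 : √(c 0 * c (N + 1)) ≠ 0 := (Real.sqrt_pos.2 (mul_pos (hc0 _) (hc0 _))).ne'
  have e9 : ∏ i ∈ Finset.range (N + 1), s i ≠ 0 := Finset.prod_ne_zero_iff.2 fun i _ => (hs0 i).ne'
  field_simp
  rfl

end Dirichlet

/-! ### The Dirichlet process -/

section DirichletProcess

variable {h : I ≃o I} {β : ℝ} {Q : Measure G0}

lemma measurable_coeFun : Measurable fun g : G0 => (g : I → I) := comap_measurable _

lemma measurable_eval (t : I) : Measurable fun g : G0 => g t :=
  (measurable_pi_apply t).comp measurable_coeFun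

lemma measurable_to_G0 {α : Type*} [MeasurableSpace α] {f : α → G0}
    (hf : ∀ t, Measurable fun a => f a t) : Measurable f :=
  measurable_comap_iff.2 (measurable_pi_iff.2 hf)

lemma measurable_tau (h : I ≃o I) : Measurable (tau h) :=
  measurable_to_G0 fun t => h.continuous.measurable.comp (measurable_eval t)

lemma measurable_nodeValues (N : ℕ) : Measurable (nodeValues N) :=
  measurable_pi_iff.2 fun _ => measurable_subtype_coe.comp (measurable_eval _)

lemma node_lt_node {m i j : ℕ} (hij : i < j) (hj : j ≤ m) : node m i < node m j := by
  have hm : 0 < m := by omega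
  change (node m i : ℝ) < node m j
  rw [coe_node hm hj, coe_node hm (hij.le.trans hj)]
  gcongr

lemma IsDirichletProcess.map_nodeValues (hQ : IsDirichletProcess β Q) (N : ℕ) :
    Q.map (nodeValues N) =
      dirichletMeasure β fun i : Fin N => (node (N + 1) (i + 1) : ℝ) := by
  refine hQ.finiteDimensional N (fun i => node (N + 1) (i + 1)) (fun i j hij => ?_) (fun i => ?_)
  · exact node_lt_node (by simpa using hij) (by omega)
  · refine ⟨?_, ?_⟩
    · rw [← node_zero (N + 1)]; exact node_lt_node (by omega) (by omega)
    · rw [← node_self (Nat.succ_pos N)]; exact node_lt_node (by omega) le_rfl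

lemma dirichletDensity_one {t : ℝ} (x : Fin 1 → ℝ) :
    dirichletDensity β (fun _ => t) x =
      ProbabilityTheory.betaPDFReal (β * t) (β * (1 - t)) (x 0) := by
  have e : ∀ y : Fin 1 → ℝ, withEnds y 0 = 0 ∧ withEnds y 1 = y 0 ∧ withEnds y 2 = 1 := fun y =>
    ⟨rfl, rfl, rfl⟩
  have hs : StrictMono (withEnds x) ↔ 0 < x 0 ∧ x 0 < 1 := by
    rw [Fin.strictMono_iff_lt_succ, Fin.forall_fin_two]
    rfl
  rw [dirichletDensity, ProbabilityTheory.betaPDFReal]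
  simp only [hs]
  refine if_congr Iff.rfl ?_ rfl
  rw [Fin.prod_univ_two, Fin.prod_univ_two]
  have e1 : (0 : Fin 2).castSucc = (0 : Fin 3) := rfl
  have e2 : (0 : Fin 2).succ = (1 : Fin 3) := rfl
  have e3 : (1 : Fin 2).castSucc = (1 : Fin 3) := rfl
  have e4 : (1 : Fin 2).succ = (2 : Fin 3) := rfl
  rw [e1, e2, e3, e4, (e x).1, (e x).2.1, (e x).2.2, (e _).1, (e _).2.1, (e _).2.2,
    ProbabilityTheory.beta]
  simp only [sub_zero]
  rw [show β * t + β * (1 - t) = β by ring, one_div_div]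
  ring

/-- Size-biasing raises the first Beta parameter by one, so the mean follows from the total mass of
another Beta law. -/
lemma mul_betaPDFReal {a b : ℝ} (ha : 0 < a) (hb : 0 < b) (x : ℝ) :
    ProbabilityTheory.betaPDFReal a b x * x =
      a / (a + b) * ProbabilityTheory.betaPDFReal (a + 1) b x := by
  rw [ProbabilityTheory.betaPDFReal, ProbabilityTheory.betaPDFReal]
  split_ifs with hx
  · rw [ProbabilityTheory.beta, ProbabilityTheory.beta, Real.Gamma_add_one ha.ne',
      show a + 1 + b = a + b + 1 by ring, Real.Gamma_add_one (by positivity),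
      show a + 1 - 1 = a - 1 + 1 by ring, Real.rpow_add_one hx.1.ne']
    have := (Real.Gamma_pos_of_pos ha).ne'
    have := (Real.Gamma_pos_of_pos hb).ne'
    have := (Real.Gamma_pos_of_pos (add_pos ha hb)).ne'
    have : a + b ≠ 0 := by positivity
    field_simp
  · simp

/-- `g(t)` has mean `t`. -/
lemma IsDirichletProcess.lintegral_eval (hQ : IsDirichletProcess β Q) (hβ : 0 < β) {t : I}
    (ht : 0 < t) (ht' : t < 1) : ∫⁻ g, ENNReal.ofReal (g t) ∂Q = ENNReal.ofReal t := by
  have h0 : (0 : ℝ) < t := ht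
  have h1 : (t : ℝ) < 1 := ht'
  have ha : 0 < β * t := by positivity
  have hb : 0 < β * (1 - t) := mul_pos hβ (by linarith)
  have hfd := hQ.finiteDimensional 1 (fun _ => t) (Subsingleton.strictMono _) (fun _ => ⟨ht, ht'⟩)
  have hm : Measurable fun x : Fin 1 → ℝ => ENNReal.ofReal (x 0) :=
    (measurable_pi_apply 0).ennreal_ofReal
  have hE : Measurable fun (g : G0) (_ : Fin 1) => (g t : ℝ) :=
    measurable_pi_iff.2 fun _ => measurable_subtype_coe.comp (measurable_eval t)
  calc ∫⁻ g, ENNReal.ofReal (g t) ∂Q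
      = ∫⁻ x, ENNReal.ofReal (x 0) ∂(Q.map fun (g : G0) (_ : Fin 1) => (g t : ℝ)) := by
        rw [lintegral_map hm hE]
    _ = ∫⁻ x : Fin 1 → ℝ, ENNReal.ofReal (ProbabilityTheory.betaPDFReal (β * t) (β * (1 - t))
          (x 0) * x 0) := by
        rw [hfd, lintegral_withDensity_eq_lintegral_mul _
          (measurable_dirichletDensity β _).ennreal_ofReal hm]
        refine lintegral_congr fun x => ?_
        rw [Pi.mul_apply, dirichletDensity_one]
        by_cases hx : 0 < x 0 ∧ x 0 < 1
        · rw [ENNReal.ofReal_mul' hx.1.le]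
        · rw [ProbabilityTheory.betaPDFReal, if_neg hx]; simp
    _ = ∫⁻ x : ℝ, ENNReal.ofReal (ProbabilityTheory.betaPDFReal (β * t) (β * (1 - t)) x * x) :=
        (volume_preserving_funUnique (Fin 1) ℝ).lintegral_comp
          (((ProbabilityTheory.measurable_betaPDFReal _ _).mul measurable_id).ennreal_ofReal)
    _ = ∫⁻ x : ℝ, ENNReal.ofReal t *
          ProbabilityTheory.betaPDF (β * t + 1) (β * (1 - t)) x := by
        refine lintegral_congr fun x => ?_
        rw [mul_betaPDFReal ha hb, show β * t / (β * t + β * (1 - t)) = (t : ℝ) by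
          rw [show β * t + β * (1 - t) = β by ring]; field_simp, ENNReal.ofReal_mul h0.le]
        rfl
    _ = ENNReal.ofReal t := by
        have hp : Measurable (ProbabilityTheory.betaPDF (β * t + 1) (β * (1 - t))) :=
          (ProbabilityTheory.measurable_betaPDFReal _ _).ennreal_ofReal
        rw [lintegral_const_mul _ hp,
          ProbabilityTheory.lintegral_betaPDF_eq_one (by positivity) hb, mul_one]

lemma IsDirichletProcess.lintegral_one_sub_eval (hQ : IsDirichletProcess β Q) (hβ : 0 < β) {t : I}
    (ht : 0 < t) (ht' : t < 1) :
    ∫⁻ g, ENNReal.ofReal (1 - g t) ∂Q = ENNReal.ofReal (1 - t) := by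
  have := hQ.isProbabilityMeasure
  have hm : Measurable fun g : G0 => (g t : ℝ) := measurable_subtype_coe.comp (measurable_eval t)
  have h1 : ∫⁻ g, ENNReal.ofReal (1 - g t) ∂Q + ∫⁻ g, ENNReal.ofReal (g t) ∂Q = 1 := by
    rw [← lintegral_add_right _ hm.ennreal_ofReal]
    simp_rw [← ENNReal.ofReal_add (sub_nonneg.2 (G0.toFun _ t).2.2) (G0.toFun _ t).2.1]
    simp
  rw [hQ.lintegral_eval hβ ht ht'] at h1
  rw [ENNReal.ofReal_sub _ t.2.1, ENNReal.ofReal_one]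
  exact ENNReal.eq_sub_of_add_eq ENNReal.ofReal_ne_top h1

lemma node_one_mem {m : ℕ} (hm : 2 ≤ m) : 0 < node m 1 ∧ node m 1 < 1 := by
  refine ⟨?_, ?_⟩
  · rw [← node_zero m]; exact node_lt_node (by omega) (by omega)
  · rw [← node_self (show 0 < m by omega)]; exact node_lt_node (by omega) le_rfl

/-- By monotonicity the mean of `g 0` is at most that of `g (1 / m)`, which is `1 / m`. -/
lemma IsDirichletProcess.ae_apply_zero (hQ : IsDirichletProcess β Q) (hβ : 0 < β) :
    ∀ᵐ g ∂Q, g 0 = 0 := by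
  have h1 : ∫⁻ g, ENNReal.ofReal (g 0) ∂Q = 0 := by
    have h2 : Tendsto (fun m : ℕ => ENNReal.ofReal (1 / (m : ℝ))) atTop (𝓝 (ENNReal.ofReal 0)) :=
      (ENNReal.continuous_ofReal.tendsto 0).comp tendsto_one_div_atTop_nhds_zero_nat
    rw [ENNReal.ofReal_zero] at h2
    refine le_antisymm (ge_of_tendsto h2 ?_) zero_le
    filter_upwards [eventually_ge_atTop 2] with m hm
    obtain ⟨a, b⟩ := node_one_mem hm
    have h3 := hQ.lintegral_eval hβ a b
    rw [coe_node (by omega) (by omega), Nat.cast_one] at h3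
    rw [← h3]
    exact lintegral_mono fun g => ENNReal.ofReal_le_ofReal (g.monotone' a.le)
  have hm : Measurable fun g : G0 => (g 0 : ℝ) := measurable_subtype_coe.comp (measurable_eval 0)
  rw [lintegral_eq_zero_iff hm.ennreal_ofReal] at h1
  filter_upwards [h1] with g hg
  have : (g 0 : ℝ) ≤ 0 := ENNReal.ofReal_eq_zero.1 hg
  exact le_antisymm this (g 0).2.1

lemma measurable_leftLim_one : Measurable fun g : G0 => Function.leftLim g 1 := by
  refine measurable_of_tendsto_metrizable (f := fun m (g : G0) => g (node m (cell m 1)))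
    (fun m => measurable_eval _) (tendsto_pi_nhds.2 fun g => ?_)
  exact (g.monotone'.tendsto_leftLim 1).comp (tendsto_node_cell zero_lt_one)

lemma IsDirichletProcess.ae_leftLim_one (hQ : IsDirichletProcess β Q) (hβ : 0 < β) :
    ∀ᵐ g : G0 ∂Q, Function.leftLim g 1 = 1 := by
  have h1 : ∫⁻ g, ENNReal.ofReal (1 - Function.leftLim (g : I → I) 1) ∂Q = 0 := by
    have h2 : Tendsto (fun m : ℕ => ENNReal.ofReal (1 / (m : ℝ))) atTop (𝓝 (ENNReal.ofReal 0)) :=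
      (ENNReal.continuous_ofReal.tendsto 0).comp tendsto_one_div_atTop_nhds_zero_nat
    rw [ENNReal.ofReal_zero] at h2
    refine le_antisymm (ge_of_tendsto h2 ?_) zero_le
    filter_upwards [eventually_ge_atTop 2] with m hm
    have b : node m (m - 1) < 1 := by
      rw [← node_self (show 0 < m by omega)]; exact node_lt_node (by omega) le_rfl
    have a : 0 < node m (m - 1) := by
      rw [← node_zero m]; exact node_lt_node (by omega) (by omega)
    have h3 := hQ.lintegral_one_sub_eval hβ a b
    have h4 : 1 - (node m (m - 1) : ℝ) = 1 / m := by
      have := node_succ_sub (show m - 1 < m by omega)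
      rwa [show m - 1 + 1 = m by omega, node_self (by omega)] at this
    rw [h4] at h3
    rw [← h3]
    exact lintegral_mono fun g => ENNReal.ofReal_le_ofReal
      (sub_le_sub_left (Subtype.coe_le_coe.2 (g.monotone'.le_leftLim b)) 1)
  have hm : Measurable fun g : G0 => ((Function.leftLim (g : I → I) 1 : I) : ℝ) :=
    measurable_subtype_coe.comp measurable_leftLim_one
  rw [lintegral_eq_zero_iff (hm.const_sub 1).ennreal_ofReal] at h1
  filter_upwards [h1] with g hg
  have : 1 - ((Function.leftLim (g : I → I) 1 : I) : ℝ) ≤ 0 := ENNReal.ofReal_eq_zero.1 hg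
  exact le_antisymm (Function.leftLim g 1).2.2 (Subtype.coe_le_coe.1 (sub_nonpos.1 this))

end DirichletProcess

/-! ### Dyadic evaluations generate the σ-algebra -/

section Generation

lemma node_mul {n m d i : ℕ} (hd : 0 < d) (hm : m = n * d) : node m (i * d) = node n i := by
  rw [node, node, hm]
  push_cast
  rw [mul_div_mul_right _ _ (by positivity)]

/-- The `σ`-algebra generated by the evaluations at the points `i / (N + 1)`. -/
noncomputable abbrev nodeSigma (N : ℕ) : MeasurableSpace G0 :=
  MeasurableSpace.comap (nodeValues N) inferInstance

lemma measurable_pi_of_forall_apply {α ι X : Type*} {𝓜 : MeasurableSpace α} [MeasurableSpace X]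
    {f : α → ι → X} (hf : ∀ i, Measurable[𝓜] fun a => f a i) : Measurable[𝓜] f :=
  measurable_pi_iff.2 hf

lemma measurable_apply_of_measurable {α ι X : Type*} {𝓜 : MeasurableSpace α} [MeasurableSpace X]
    {f : α → ι → X} (hf : Measurable[𝓜] f) (i : ι) : Measurable[𝓜] fun a => f a i :=
  (measurable_pi_apply i).comp hf

lemma nodeSigma_le_of_dvd {N M : ℕ} (hd : N + 1 ∣ M + 1) : nodeSigma N ≤ nodeSigma M := by
  obtain ⟨d, hd⟩ := hd
  have hd0 : 0 < d := by
    rcases Nat.eq_zero_or_pos d with e | e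
    · subst e; simp at hd
    · exact e
  refine measurable_iff_comap_le.1 (measurable_pi_of_forall_apply (𝓜 := nodeSigma M) fun i => ?_)
  have h1 : (i + 1) * d ≤ M := by
    have := Nat.mul_le_mul_right d (show (i : ℕ) + 1 ≤ N from i.2)
    rw [Nat.add_mul] at hd
    omega
  have h2 : 0 < ((i : ℕ) + 1) * d := by positivity
  have h3 : (fun g => nodeValues N g i) =
      fun g => nodeValues M g ⟨(i + 1) * d - 1, by omega⟩ := by
    funext g
    rw [nodeValues, nodeValues, Nat.sub_add_cancel h2, node_mul hd0 hd]
  rw [h3]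
  exact measurable_apply_of_measurable (𝓜 := nodeSigma M) (comap_measurable _) _

lemma two_pow_sub_add (n : ℕ) : 2 ^ n - 1 + 1 = 2 ^ n := Nat.sub_add_cancel Nat.one_le_two_pow

/-- Since `nodeSigma N` belongs to `N + 1` intervals, the index `2 ^ n - 1` is the dyadic partition
of level `n`. -/
lemma nodeSigma_mono : Monotone fun n => nodeSigma (2 ^ n - 1) := fun n k hnk =>
  nodeSigma_le_of_dvd (by rw [two_pow_sub_add, two_pow_sub_add]; exact pow_dvd_pow 2 hnk)

/-- Nodes to the right of `t` let right continuity recover `g t`. -/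
lemma tendsto_node_floor {t : I} (ht : t < 1) :
    Tendsto (fun m : ℕ => node m (⌊(t : ℝ) * m⌋₊ + 1)) atTop (𝓝[≥] t) := by
  have key : ∀ m : ℕ, 0 < m → (t : ℝ) ≤ node m (⌊(t : ℝ) * m⌋₊ + 1) ∧
      (node m (⌊(t : ℝ) * m⌋₊ + 1) : ℝ) ≤ t + 1 / m := by
    intro m hm
    have hm' : (0 : ℝ) < m := by exact_mod_cast hm
    have h1 : (t : ℝ) < 1 := ht
    have h2 : ⌊(t : ℝ) * m⌋₊ < m :=
      (Nat.floor_lt (mul_nonneg t.2.1 hm'.le)).2 (mul_lt_of_lt_one_left hm' h1)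
    rw [coe_node hm h2]
    push_cast
    constructor
    · rw [le_div_iff₀ hm']; exact (Nat.lt_floor_add_one _).le
    · rw [add_div]
      gcongr
      rw [div_le_iff₀ hm']; exact Nat.floor_le (mul_nonneg t.2.1 hm'.le)
  rw [tendsto_nhdsWithin_iff]
  constructor
  · rw [tendsto_subtype_rng]
    have h1 : Tendsto (fun m : ℕ => (t : ℝ) + 1 / m) atTop (𝓝 (t + 0)) :=
      tendsto_const_nhds.add tendsto_one_div_atTop_nhds_zero_nat
    rw [add_zero] at h1
    refine tendsto_of_tendsto_of_tendsto_of_le_of_le' tendsto_const_nhds h1 ?_ ?_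
    · filter_upwards [eventually_gt_atTop 0] with m hm using (key m hm).1
    · filter_upwards [eventually_gt_atTop 0] with m hm using (key m hm).2
  · filter_upwards [eventually_gt_atTop 0] with m hm using (key m hm).1

lemma tendsto_two_pow : Tendsto (fun n : ℕ => 2 ^ n) atTop atTop :=
  tendsto_pow_atTop_atTop_of_one_lt one_lt_two

lemma measurable_eval_node {𝓜 : MeasurableSpace G0} {N : ℕ} (hM : nodeSigma N ≤ 𝓜) (i : ℕ) :
    Measurable[𝓜] fun g : G0 => g (node (N + 1) (i + 1)) := by
  by_cases hi : i < N
  · have h1 : Measurable[𝓜] (nodeValues N) := measurable_iff_comap_le.2 hM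
    have h2 : (fun g : G0 => g (node (N + 1) (i + 1))) =
        fun g => projIcc 0 1 zero_le_one (nodeValues N g ⟨i, hi⟩) := by
      funext g; rw [nodeValues, projIcc_val]
    rw [h2]
    exact continuous_projIcc.measurable.comp (measurable_apply_of_measurable h1 _)
  · have h1 : node (N + 1) (i + 1) = 1 :=
      le_antisymm (node (N + 1) (i + 1)).2.2
        ((node_self (Nat.succ_pos N)).symm.trans_le (node_mono _ (by omega)))
    have h2 : (fun g : G0 => g (node (N + 1) (i + 1))) = fun _ => 1 := by
      funext g; rw [h1, g.map_one']
    rw [h2]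
    exact measurable_const

lemma le_of_forall_nodeSigma_le {𝓜 : MeasurableSpace G0}
    (hM : ∀ n : ℕ, nodeSigma (2 ^ n - 1) ≤ 𝓜) :
    instMeasurableSpaceG0 ≤ 𝓜 := by
  change MeasurableSpace.comap (fun g : G0 => (g : I → I)) MeasurableSpace.pi ≤ 𝓜
  refine measurable_iff_comap_le.1 (measurable_pi_of_forall_apply (𝓜 := 𝓜) fun t => ?_)
  rcases t.2.2.lt_or_eq with ht | ht
  · refine measurable_of_tendsto_metrizable
      (f := fun n (g : G0) => g (node (2 ^ n) (⌊(t : ℝ) * (2 ^ n : ℕ)⌋₊ + 1)))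
      (fun n => ?_) (tendsto_pi_nhds.2 fun g => ?_)
    · have := measurable_eval_node (hM n) ⌊(t : ℝ) * (2 ^ n : ℕ)⌋₊
      rwa [two_pow_sub_add] at this
    · exact (g.rightCts' t).tendsto.comp ((tendsto_node_floor ht).comp tendsto_two_pow)
  · have h2 : (fun g : G0 => g t) = fun _ => 1 := by
      funext g; rw [show t = 1 from Subtype.ext ht, g.map_one']
    rw [h2]
    exact measurable_const

lemma nodeSigma_le (N : ℕ) : nodeSigma N ≤ instMeasurableSpaceG0 :=
  (measurable_nodeValues N).comap_le

/-- Finite measures on `G0` which agree on dyadic cylinder sets coincide. -/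
lemma ext_of_dyadic {P P' : Measure G0} [IsFiniteMeasure P]
    (hP : ∀ n A, MeasurableSet[nodeSigma (2 ^ n - 1)] A → P A = P' A) : P = P' := by
  refine ext_of_generate_finite {A | ∃ n, MeasurableSet[nodeSigma (2 ^ n - 1)] A} ?_ ?_ ?_ ?_
  · refine le_antisymm (le_of_forall_nodeSigma_le fun n A hA =>
      MeasurableSpace.measurableSet_generateFrom
        (show A ∈ {A | ∃ n, MeasurableSet[nodeSigma (2 ^ n - 1)] A} from ⟨n, hA⟩)) (MeasurableSpace.generateFrom_le ?_)
    rintro A ⟨n, hA⟩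
    exact nodeSigma_le _ A hA
  · rintro A ⟨n, hA⟩ B ⟨k, hB⟩ -
    exact ⟨max n k, (nodeSigma_mono (le_max_left n k) A hA).inter
      (nodeSigma_mono (le_max_right n k) B hB)⟩
  · rintro A ⟨n, hA⟩
    exact hP n A hA
  · exact hP 0 univ MeasurableSet.univ

end Generation

/-! ### The density of the transformed Dirichlet process -/

section QuasiInvariance

variable {h : I ≃o I} {β : ℝ} {Q : Measure G0}

lemma nodeValues_tau (h : I ≃o I) (N : ℕ) (g : G0) :
    nodeValues N (tau h g) = fun i => extFun h (nodeValues N g i) := by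
  funext i
  rw [nodeValues, nodeValues, extFun_apply]
  rfl

/-- On events seen by the partition the approximate density is exact, because `nodeValues`
intertwines `tau` with the coordinatewise map. -/
lemma IsDirichletProcess.map_tau_apply (hQ : IsDirichletProcess β Q) (hβ : 0 < β) (hh : IsC2Iso h)
    (N : ℕ) {A : Set G0} (hA : MeasurableSet[nodeSigma N] A) :
    Q.map (tau h.symm) A = ∫⁻ g in A, ENNReal.ofReal (YApprox β h (N + 1) g) ∂Q := by
  obtain ⟨B, hB, rfl⟩ := hA
  have hE := measurable_nodeValues N
  have hK : Measurable fun (x : Fin N → ℝ) i => extFun h.symm (x i) :=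
    measurable_pi_lambda _ fun i => ((continuous_extFun h.symm).comp (continuous_apply i)).measurable
  have hR := (hh.measurable_dirichletRatio β
    (fun i : Fin N => (node (N + 1) (i + 1) : ℝ))).ennreal_ofReal
  have hcomp : nodeValues N ∘ tau h.symm = (fun x i => extFun h.symm (x i)) ∘ nodeValues N :=
    funext fun g => nodeValues_tau h.symm N g
  rw [← Measure.map_apply hE hB, Measure.map_map hE (measurable_tau _), hcomp,
    ← Measure.map_map hK hE, hQ.map_nodeValues, hh.map_dirichletMeasure, withDensity_apply _ hB,
    ← hQ.map_nodeValues, setLIntegral_map hB hR hE]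
  refine setLIntegral_congr_fun_ae (hE hB) ?_
  filter_upwards [hQ.ae_apply_zero hβ] with g hg _
  rw [hh.dirichletRatio_nodeValues β g hg]

lemma IsDirichletProcess.ae_tendsto_YApprox (hQ : IsDirichletProcess β Q) (hβ : 0 < β)
    (hh : IsC2Iso h) :
    ∀ᵐ g ∂Q, Tendsto (fun n => YApprox β h (2 ^ n) g) atTop (𝓝 (Y β h g)) := by
  filter_upwards [hQ.ae_apply_zero hβ, hQ.ae_leftLim_one hβ] with g h0 h1
  exact (hh.tendsto_YApprox β g h0 h1).comp tendsto_two_pow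

lemma measurable_comp_eval_pair {Ψ : I × I → ℝ} (hΨ : Continuous Ψ) (s t : I) :
    Measurable fun g : G0 => Ψ (g s, g t) :=
  hΨ.measurable.comp ((measurable_eval s).prodMk (measurable_eval t))

lemma IsC2Iso.measurable_YApprox (hh : IsC2Iso h) (β : ℝ) (m : ℕ) :
    Measurable (YApprox β h m) := by
  have hs : ∀ i, Measurable fun g : G0 =>
      Real.log (slopeI h (g (node m i)) (g (node m (i + 1)))) := fun i =>
    measurable_comp_eval_pair hh.continuous_log_slopeI (node m i) (node m (i + 1))
  have hj : ∀ i, Measurable fun g : G0 =>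
      logJumpRate h (g (node m i)) (g (node m (i + 1))) := fun i =>
    measurable_comp_eval_pair hh.continuous_logJumpRate (node m i) (node m (i + 1))
  have he : ∀ i, Measurable fun g : G0 => (g (node m i) : ℝ) := fun i =>
    measurable_subtype_coe.comp (measurable_eval (node m i))
  have hA : Measurable fun g : G0 => ∑ i ∈ Finset.range m, ((node m (i + 1) : ℝ) - node m i) *
      Real.log (slopeI h (g (node m i)) (g (node m (i + 1)))) :=
    Finset.measurable_fun_sum _ fun i _ => (hs i).const_mul _
  have hB : Measurable fun g : G0 => ∑ i ∈ Finset.range m,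
      ((g (node m (i + 1)) : ℝ) - g (node m i)) *
        logJumpRate h (g (node m i)) (g (node m (i + 1))) :=
    Finset.measurable_fun_sum _ fun i _ => ((he (i + 1)).sub (he i)).mul (hj i)
  exact (Real.measurable_exp.comp ((hA.const_mul β).add hB)).const_mul _

lemma IsDirichletProcess.aemeasurable_Y (hQ : IsDirichletProcess β Q) (hβ : 0 < β)
    (hh : IsC2Iso h) : AEMeasurable (Y β h) Q :=
  aemeasurable_of_tendsto_metrizable_ae atTop
    (fun _ => (hh.measurable_YApprox β _).aemeasurable) (hQ.ae_tendsto_YApprox hβ hh)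

theorem IsDirichletProcess.map_tau_symm (hQ : IsDirichletProcess β Q) (hβ : 0 < β)
    (hh : IsC2Iso h) :
    Q.map (tau h.symm) = Q.withDensity fun g => ENNReal.ofReal (Y β h g) := by
  have := hQ.isProbabilityMeasure
  refine ext_of_dyadic fun n A hA => ?_
  obtain ⟨C, hC⟩ := hh.exists_YApprox_bound β
  have h1 : Tendsto (fun k => ∫⁻ g in A, ENNReal.ofReal (YApprox β h (2 ^ k) g) ∂Q) atTop
      (𝓝 (∫⁻ g in A, ENNReal.ofReal (Y β h g) ∂Q)) := by
    refine tendsto_lintegral_of_dominated_convergence (fun _ => ENNReal.ofReal C)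
      (fun k => (hh.measurable_YApprox β _).ennreal_ofReal)
      (fun k => Eventually.of_forall fun g =>
        ENNReal.ofReal_le_ofReal ((le_abs_self _).trans (hC _ g))) ?_ ?_
    · rw [lintegral_const]
      exact ENNReal.mul_ne_top ENNReal.ofReal_ne_top (measure_ne_top _ _)
    · filter_upwards [ae_restrict_of_ae (hQ.ae_tendsto_YApprox hβ hh)] with g hg
      exact (ENNReal.continuous_ofReal.tendsto _).comp hg
  rw [withDensity_apply _ (nodeSigma_le _ A hA)]
  -- For `k ≥ n` the event `A` is visible at level `k`, so the integrals are constant in `k`.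
  refine tendsto_nhds_unique (tendsto_const_nhds.congr' ?_) h1
  filter_upwards [eventually_ge_atTop n] with k hk
  have h2 := hQ.map_tau_apply hβ hh (2 ^ k - 1) (nodeSigma_mono hk A hA)
  rwa [two_pow_sub_add] at h2

end QuasiInvariance

/-! ### Probability measures on the interval and their quantile functions -/

section Quantile

/-- The distribution function of `μ`. -/
noncomputable def cdfI (μ : ProbabilityMeasure I) (x : I) : I :=
  ⟨(μ : Measure I).real (Iic x), measureReal_nonneg, measureReal_le_one⟩

lemma measure_Iic_eq (μ : ProbabilityMeasure I) (x : I) :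
    (μ : Measure I) (Iic x) = ENNReal.ofReal (cdfI μ x) :=
  (ENNReal.ofReal_toReal (measure_ne_top _ _)).symm

lemma cdfI_mono (μ : ProbabilityMeasure I) : Monotone (cdfI μ) := fun _ _ hxy =>
  Subtype.coe_le_coe.1 (measureReal_mono (Iic_subset_Iic.2 hxy))

lemma cdfI_one (μ : ProbabilityMeasure I) : cdfI μ 1 = 1 := by
  apply Subtype.ext
  have : Iic (1 : I) = univ := eq_univ_of_forall fun x => x.2.2
  simp [cdfI, this]

lemma le_cdfI_of_forall_gt (μ : ProbabilityMeasure I) {t x : I} (ht : ∀ y > x, t ≤ cdfI μ y) :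
    t ≤ cdfI μ x := by
  rcases x.2.2.lt_or_eq with hx | hx
  · have hx' : x < 1 := hx
    have hne : (𝓝[>] x).NeBot := nhdsGT_neBot_of_exists_gt ⟨1, hx'⟩
    have h1 := tendsto_measure_biInter_gt (μ := (μ : Measure I)) (s := fun y : I => Iic y) (a := x)
      (fun _ _ => measurableSet_Iic.nullMeasurableSet) (fun _ _ _ hij => Iic_subset_Iic.2 hij)
      ⟨1, hx', measure_ne_top _ _⟩
    have h2 : ⋂ r > x, Iic r = Iic x := by
      ext z
      simp only [mem_iInter, mem_Iic]
      exact ⟨fun hz => le_of_forall_gt_imp_ge_of_dense hz, fun hz r hr => hz.trans hr.le⟩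
    rw [h2] at h1
    have h3 : ENNReal.ofReal t ≤ (μ : Measure I) (Iic x) := by
      refine ge_of_tendsto h1 ?_
      filter_upwards [self_mem_nhdsWithin] with y hy
      rw [Function.comp_apply, measure_Iic_eq]
      exact ENNReal.ofReal_le_ofReal (ht y hy)
    rw [measure_Iic_eq, ENNReal.ofReal_le_ofReal_iff (cdfI μ x).2.1] at h3
    exact h3
  · have hx' : x = 1 := Subtype.ext hx
    rw [hx', cdfI_one]
    exact t.2.2

/-- The right continuous quantile function of `μ`. -/
noncomputable def quantileFun (μ : ProbabilityMeasure I) (t : I) : I := sInf {x | t < cdfI μ x}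

lemma quantileFun_le {μ : ProbabilityMeasure I} {t x : I} (ht : t < cdfI μ x) :
    quantileFun μ t ≤ x := sInf_le ht

lemma quantileFun_lt_iff {μ : ProbabilityMeasure I} {t b : I} :
    quantileFun μ t < b ↔ ∃ x < b, t < cdfI μ x := by
  rw [quantileFun, sInf_lt_iff]
  exact ⟨fun ⟨x, hx, hxb⟩ => ⟨x, hxb, hx⟩, fun ⟨x, hxb, hx⟩ => ⟨x, hx, hxb⟩⟩

lemma quantileFun_mono (μ : ProbabilityMeasure I) : Monotone (quantileFun μ) := fun _ _ hst =>
  sInf_le_sInf fun _ hx => hst.trans_lt hx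

/-- The quantile function as an element of `G0`. -/
noncomputable def quantile (μ : ProbabilityMeasure I) : G0 where
  toFun := quantileFun μ
  monotone' := quantileFun_mono μ
  rightCts' := fun t => by
    refine tendsto_order.2 ⟨fun a ha => ?_, fun b hb => ?_⟩
    · filter_upwards [self_mem_nhdsWithin] with s hs
      exact ha.trans_le (quantileFun_mono μ hs)
    · obtain ⟨x, hxb, hx⟩ := quantileFun_lt_iff.1 hb
      filter_upwards [mem_nhdsWithin_of_mem_nhds (Iio_mem_nhds hx)] with s hs
      exact quantileFun_lt_iff.2 ⟨x, hxb, hs⟩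
  map_one' := by
    -- At `t = 1` the infimum is over the empty set, hence the top element 1.
    have : {x | 1 < cdfI μ x} = ∅ := eq_empty_of_forall_notMem fun x hx => hx.not_ge (cdfI μ x).2.2
    rw [quantileFun, this, sInf_empty]; rfl

lemma quantile_apply (μ : ProbabilityMeasure I) (t : I) : quantile μ t = quantileFun μ t := rfl

lemma chi_apply (g : G0) {A : Set I} (hA : MeasurableSet A) :
    (chi g : Measure I) A = volume (g ⁻¹' A) :=
  Measure.map_apply g.monotone'.measurable hA

/-- With `F` the distribution function, `{quantile ≤ x}` lies between `[0, F(x)[` and `[0, F(x)]`,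
which have equal length. -/
lemma chi_quantile (μ : ProbabilityMeasure I) : chi (quantile μ) = μ := by
  apply Subtype.ext
  have : IsFiniteMeasure ((chi (quantile μ)).1 : Measure I) :=
    inferInstanceAs (IsFiniteMeasure (chi (quantile μ) : Measure I))
  refine Measure.ext_of_Iic _ _ fun x => ?_
  change (chi (quantile μ) : Measure I) (Iic x) = (μ : Measure I) (Iic x)
  rw [chi_apply _ measurableSet_Iic, measure_Iic_eq]
  refine le_antisymm ?_ ?_
  · rw [← unitInterval.volume_Iic]
    refine measure_mono fun t ht => ?_
    refine le_cdfI_of_forall_gt μ fun y hy => ?_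
    obtain ⟨z, hzy, hz⟩ := quantileFun_lt_iff.1 (lt_of_le_of_lt (show quantileFun μ t ≤ x from ht) hy)
    exact hz.le.trans (cdfI_mono μ hzy.le)
  · rw [← unitInterval.volume_Iio]
    exact measure_mono fun t ht => quantileFun_le ht

lemma le_cdfI_chi {g : G0} {t x : I} (hx : g t ≤ x) : t ≤ cdfI (chi g) x := by
  have h1 : ENNReal.ofReal t ≤ (chi g : Measure I) (Iic x) := by
    rw [chi_apply _ measurableSet_Iic, ← unitInterval.volume_Iic]
    exact measure_mono fun s hs => (g.monotone' hs).trans hx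
  rw [measure_Iic_eq, ENNReal.ofReal_le_ofReal_iff (cdfI _ x).2.1] at h1
  exact h1

lemma cdfI_chi_le {g : G0} {t x : I} (hx : x < g t) : cdfI (chi g) x ≤ t := by
  have h1 : (chi g : Measure I) (Iic x) ≤ ENNReal.ofReal t := by
    rw [chi_apply _ measurableSet_Iic, ← unitInterval.volume_Iio]
    exact measure_mono fun s hs => g.monotone'.reflect_lt (lt_of_le_of_lt hs hx)
  rw [measure_Iic_eq, ENNReal.ofReal_le_ofReal_iff t.2.1] at h1
  exact h1

lemma G0.ext' {g g' : G0} (hg : ∀ t, g t = g' t) : g = g' := by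
  cases g; cases g'
  congr
  exact funext hg

lemma quantile_chi (g : G0) : quantile (chi g) = g := by
  refine G0.ext' fun t => le_antisymm ?_ ?_
  · rcases t.2.2.lt_or_eq with ht | ht
    · have ht' : t < 1 := ht
      have hne : (𝓝[>] t).NeBot := nhdsGT_neBot_of_exists_gt ⟨1, ht'⟩
      refine le_of_forall_gt_imp_ge_of_dense fun b hb => ?_
      have h1 : ∀ᶠ s in 𝓝[>] t, g s < b :=
        ((g.rightCts' t).mono Ioi_subset_Ici_self).tendsto.eventually (eventually_lt_nhds hb)
      obtain ⟨s, hs, hs'⟩ := (h1.and self_mem_nhdsWithin).exists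
      exact (quantileFun_le (lt_of_lt_of_le hs' (le_cdfI_chi le_rfl))).trans hs.le
    · rw [show t = 1 from Subtype.ext ht, g.map_one']
      exact (quantile (chi g) 1).2.2
  · refine le_sInf fun x hx => le_of_not_gt fun hlt => ?_
    exact (cdfI_chi_le hlt).not_gt hx

lemma measurable_cdfI (x : I) : Measurable fun μ => cdfI μ x :=
  (((Measure.measurable_coe measurableSet_Iic).comp measurable_subtype_coe).ennreal_toReal).subtype_mk

/-- A countable dense set of times expresses superlevel sets through countably many evaluations. -/
lemma measurable_cdfI_chi (x : I) : Measurable fun g => cdfI (chi g) x := by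
  obtain ⟨D, hD, hDd⟩ := TopologicalSpace.exists_countable_dense I
  refine measurable_of_Ioi fun c => ?_
  have : (fun g => cdfI (chi g) x) ⁻¹' Ioi c = ⋃ q ∈ D ∩ Ioi c, {g : G0 | g q ≤ x} := by
    ext g
    simp only [mem_preimage, mem_Ioi, mem_iUnion, mem_inter_iff, exists_prop]
    constructor
    · intro hc
      obtain ⟨q, hqD, hq⟩ := hDd.exists_between hc
      exact ⟨q, ⟨hqD, hq.1⟩, le_of_not_gt fun hx => (cdfI_chi_le hx).not_gt hq.2⟩
    · rintro ⟨q, ⟨-, hq⟩, hx⟩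
      exact lt_of_lt_of_le hq (le_cdfI_chi hx)
  rw [this]
  exact MeasurableSet.biUnion (hD.mono inter_subset_left) fun q _ =>
    measurable_eval q measurableSet_Iic

lemma measurable_chi : Measurable chi := by
  have key : Measurable fun g => (chi g : Measure I) := by
    refine Measurable.measure_of_isPiSystem_of_isProbabilityMeasure
      (S := range (Iic : I → Set I)) ?_ ?_ ?_
    · rw [BorelSpace.measurable_eq (α := I), borel_eq_generateFrom_Iic]
    · exact isPiSystem_Iic
    · rintro _ ⟨x, rfl⟩
      have h1 : (fun g => (chi g : Measure I) (Iic x)) =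
          fun g => ENNReal.ofReal (cdfI (chi g) x) := funext fun g => measure_Iic_eq _ _
      rw [h1]
      exact (measurable_subtype_coe.comp (measurable_cdfI_chi x)).ennreal_ofReal
  exact key.subtype_mk

lemma measurable_quantile : Measurable quantile := by
  obtain ⟨D, hD, hDd⟩ := TopologicalSpace.exists_countable_dense I
  refine measurable_to_G0 fun t => measurable_of_Iio fun b => ?_
  have : (fun μ => quantile μ t) ⁻¹' Iio b = ⋃ q ∈ D ∩ Iio b, {μ | t < cdfI μ q} := by
    ext μ
    simp only [mem_preimage, mem_Iio, mem_iUnion, mem_inter_iff, exists_prop, quantile_apply,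
      quantileFun_lt_iff]
    constructor
    · rintro ⟨x, hxb, hx⟩
      obtain ⟨q, hqD, hq⟩ := hDd.exists_between hxb
      exact ⟨q, ⟨hqD, hq.2⟩, lt_of_lt_of_le hx (cdfI_mono μ hq.1.le)⟩
    · rintro ⟨q, ⟨-, hq⟩, hx⟩
      exact ⟨q, hq, hx⟩
  rw [this]
  exact MeasurableSet.biUnion (hD.mono inter_subset_left) fun q _ =>
    measurable_cdfI q measurableSet_Ioi

/-- `χ` is an isomorphism of measurable spaces. -/
noncomputable def chiEquiv : G0 ≃ᵐ ProbabilityMeasure I where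
  toFun := chi
  invFun := quantile
  left_inv := quantile_chi
  right_inv := chi_quantile
  measurable_toFun := measurable_chi
  measurable_invFun := measurable_quantile

lemma chi_tau (h : I ≃o I) (g : G0) : chi (tau h g) = pushforward h (chi g) := by
  apply Subtype.ext
  exact (Measure.map_map h.continuous.measurable g.monotone'.measurable).symm

end Quantile

/-! ### Gaps and jumps -/

section GapsJumps

variable {g : G0}

lemma exists_lt_apply_of_lt_leftLim {a y : I} (ha : 0 < a) (hy : y < Function.leftLim g a) :
    ∃ t < a, y < g t := by
  have : (𝓝[<] a).NeBot := nhdsLT_neBot_of_exists_lt ⟨0, ha⟩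
  obtain ⟨t, ht, ht'⟩ := (((g.monotone'.tendsto_leftLim a).eventually
    (eventually_gt_nhds hy)).and self_mem_nhdsWithin).exists
  exact ⟨t, ht', ht⟩

lemma exists_gt_apply_lt {a y : I} (ha : a < 1) (hy : g a < y) : ∃ t > a, g t < y := by
  have hne : (𝓝[>] a).NeBot := nhdsGT_neBot_of_exists_gt ⟨1, ha⟩
  have h1 : ∀ᶠ s in 𝓝[>] a, g s < y :=
    ((g.rightCts' a).mono Ioi_subset_Ici_self).tendsto.eventually (eventually_lt_nhds hy)
  obtain ⟨s, hs, hs'⟩ := (h1.and self_mem_nhdsWithin).exists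
  exact ⟨s, hs', hs⟩

lemma chi_Ioo_ne_zero {x y s t : I} (hst : s < t) (hg : ∀ u ∈ Ioo s t, g u ∈ Ioo x y) :
    (chi g : Measure I) (Ioo x y) ≠ 0 := by
  rw [chi_apply g measurableSet_Ioo]
  intro h0
  have h1 : volume (Ioo s t) = 0 := measure_mono_null hg h0
  rw [unitInterval.volume_Ioo, ENNReal.ofReal_eq_zero, sub_nonpos] at h1
  exact hst.not_ge h1

lemma chi_Ioo_jump (a : I) : (chi g : Measure I) (Ioo (Function.leftLim g a) (g a)) = 0 := by
  rw [chi_apply g measurableSet_Ioo]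
  have : g ⁻¹' Ioo (Function.leftLim g a) (g a) = ∅ := by
    refine eq_empty_of_forall_notMem fun s hs => ?_
    rcases lt_or_ge s a with h1 | h1
    · exact hs.1.not_ge (g.monotone'.le_leftLim h1)
    · exact hs.2.not_ge (g.monotone' h1)
  rw [this, measure_empty]

/-- Enlarging the interval at either end captures the values of `g` on a time interval of positive
length next to `a`. -/
lemma jump_mem_gaps {a : I} (ha : a ∈ jumps g) : (Function.leftLim g a, g a) ∈ gaps (chi g) := by
  obtain ⟨ha0, ha1, hj⟩ := ha
  refine ⟨hj, chi_Ioo_jump a, fun q hq1 hq2 hq => ?_⟩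
  have e1 : q.1 = Function.leftLim g a := by
    refine le_antisymm hq1 (le_of_not_gt fun hlt => ?_)
    obtain ⟨t, hta, ht⟩ := exists_lt_apply_of_lt_leftLim ha0 hlt
    refine chi_Ioo_ne_zero hta (fun u hu => ⟨?_, ?_⟩) hq
    · exact ht.trans_le (g.monotone' hu.1.le)
    · exact (g.monotone'.le_leftLim hu.2).trans_lt (lt_of_lt_of_le hj hq2)
  have e2 : q.2 = g a := by
    refine le_antisymm (le_of_not_gt fun hlt => ?_) hq2
    obtain ⟨t, hat, ht⟩ := exists_gt_apply_lt ha1 hlt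
    refine chi_Ioo_ne_zero hat (fun u hu => ⟨?_, ?_⟩) hq
    · exact (lt_of_le_of_lt hq1 hj).trans_le (g.monotone' hu.1.le)
    · exact (g.monotone' hu.2.le).trans_lt ht
  exact Prod.ext e1 e2

/-- The jump sits at the first time `g` reaches the right end of the gap; `h0` and `h1` keep it away
from 0 and 1. -/
lemma exists_jump_of_mem_gaps (h0 : g 0 = 0) (h1 : Function.leftLim g 1 = 1) {p : I × I}
    (hp : p ∈ gaps (chi g)) : ∃ a ∈ jumps g, (Function.leftLim g a, g a) = p := by
  obtain ⟨hlt, hnull, hmax⟩ := hp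
  set a := leftInv g p.2
  have ha : p.2 ≤ g a := le_apply_leftInv g p.2
  have ha0 : 0 < a := by
    rw [lt_leftInv_iff, h0]
    exact lt_of_le_of_lt p.1.2.1 hlt
  have hle : Function.leftLim g a ≤ p.1 := by
    refine le_of_not_gt fun hgt => ?_
    obtain ⟨t, hta, ht⟩ := exists_lt_apply_of_lt_leftLim ha0 hgt
    exact chi_Ioo_ne_zero hta (fun u hu => ⟨ht.trans_le (g.monotone' hu.1.le),
      (lt_leftInv_iff g).1 hu.2⟩) hnull
  have ha1 : a < 1 := by
    refine lt_of_le_of_ne a.2.2 fun e => ?_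
    rw [e, h1] at hle
    exact (lt_of_le_of_lt hle hlt).not_ge p.2.2.2
  exact ⟨a, ⟨ha0, ha1, lt_of_le_of_lt hle (lt_of_lt_of_le hlt ha)⟩,
    hmax (Function.leftLim g a, g a) hle ha (chi_Ioo_jump a)⟩

/-- The jumps of `g` correspond to the gaps of `χ(g)`. -/
noncomputable def jumpsEquivGaps (h0 : g 0 = 0) (h1 : Function.leftLim g 1 = 1) :
    jumps g ≃ gaps (chi g) :=
  Equiv.ofBijective (fun a => ⟨(Function.leftLim g a, g a), jump_mem_gaps a.2⟩) <| by
    constructor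
    · intro a b hab
      by_contra hne
      have hd : Disjoint (Ioo (Function.leftLim g a) (g a)) (Ioo (Function.leftLim g b) (g b)) :=
        pairwise_disjoint_jumps g hne
      have e : (Function.leftLim g a, g a) = (Function.leftLim g b, g b) := congrArg Subtype.val hab
      rw [Prod.mk.injEq] at e
      rw [← e.1, ← e.2, disjoint_self] at hd
      exact (nonempty_Ioo.2 (jumps_lt g a)).ne_empty hd
    · rintro ⟨p, hp⟩
      obtain ⟨a, ha, hap⟩ := exists_jump_of_mem_gaps h0 h1 hp
      exact ⟨⟨a, ha⟩, Subtype.ext hap⟩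

lemma IsC2Iso.gapDensity_chi {h : I ≃o I} (hh : IsC2Iso h) (β : ℝ) (h0 : g 0 = 0)
    (h1 : Function.leftLim g 1 = 1) : gapDensity β h (chi g) = Y β h g := by
  have hc : Continuous fun x => Real.log (dh h x) :=
    hh.continuous_dh.log fun x => (hh.dh_pos x).ne'
  have e1 : ∫ s : I, Real.log (dh h s) ∂(chi g : Measure I) =
      ∫ s : I, Real.log (dh h (g s)) :=
    integral_map g.monotone'.measurable.aemeasurable hc.aestronglyMeasurable
  have e2 : ∏' p : gaps (chi g), jumpFactor h p.1.1 p.1.2 = Y0 h g :=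
    ((jumpsEquivGaps h0 h1).tprod_eq fun p : gaps (chi g) => jumpFactor h p.1.1 p.1.2).symm
  rw [gapDensity, e1, e2, Y, X, mul_assoc]

end GapsJumps

/-! ### Quasi-invariance -/

section Main

variable {h : I ≃o I} {β : ℝ} {Q : Measure G0}

lemma IsDirichletProcess.absolutelyContinuous_tau_symm (hQ : IsDirichletProcess β Q) (hβ : 0 < β)
    (hh : IsC2Iso h) : Q.map (tau h.symm) ≪ Q ∧ Q ≪ Q.map (tau h.symm) := by
  obtain ⟨c, C, hc, hY⟩ := hh.exists_Y_bounds β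
  rw [hQ.map_tau_symm hβ hh]
  refine ⟨withDensity_absolutelyContinuous _ _, withDensity_absolutelyContinuous'
    (hQ.aemeasurable_Y hβ hh).ennreal_ofReal (Filter.Eventually.of_forall fun g => ?_)⟩
  exact (ENNReal.ofReal_pos.2 (hc.trans_le (hY g).1)).ne'

lemma map_pushforward_map_chi (h : I ≃o I) (Q : Measure G0) :
    (Q.map chi).map (pushforward h) = (Q.map (tau h)).map chi := by
  have hp : pushforward h = chi ∘ tau h ∘ quantile := funext fun μ => by
    rw [Function.comp_apply, Function.comp_apply, chi_tau, chi_quantile]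
  have hpm : Measurable (pushforward h) :=
    hp ▸ measurable_chi.comp ((measurable_tau h).comp measurable_quantile)
  rw [Measure.map_map hpm measurable_chi, Measure.map_map measurable_chi (measurable_tau h)]
  congr 1
  exact funext fun g => (chi_tau h g).symm

/-- As `χ` is a measurable embedding, the density transfers without measurability of `f`. -/
lemma map_chi_withDensity (Q : Measure G0) {f : ProbabilityMeasure I → ENNReal} :
    (Q.withDensity (f ∘ chi)).map chi = (Q.map chi).withDensity f := by
  ext A hA
  rw [Measure.map_apply measurable_chi hA, withDensity_apply _ (measurable_chi hA),
    withDensity_apply _ hA]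
  have he : MeasurableEmbedding chi := chiEquiv.measurableEmbedding
  rw [he.restrict_map, he.lintegral_map]
  rfl

end Main

end EntropicMeasure

theorem mainTheorem2 (β : ℝ) (hβ : 0 < β) (h : I ≃o I) (hh : EntropicMeasure.IsC2Iso h) :
    -- the infinite products converge, and the density is bounded above and away from zero
    (∀ g : EntropicMeasure.G0, Multipliable (fun a : EntropicMeasure.jumps g =>
      EntropicMeasure.jumpFactor h (Function.leftLim g a) (g a))) ∧
    (∃ c C : ℝ, 0 < c ∧ ∀ g : EntropicMeasure.G0,
      c ≤ EntropicMeasure.Y β h g ∧ EntropicMeasure.Y β h g ≤ C) ∧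
    (∀ μ : ProbabilityMeasure I, Multipliable (fun p : EntropicMeasure.gaps μ =>
      EntropicMeasure.jumpFactor h p.1.1 p.1.2)) ∧
    ∀ Q : Measure EntropicMeasure.G0, EntropicMeasure.IsDirichletProcess β Q →
      -- quasi-invariance of the Dirichlet process
      (Q.map (EntropicMeasure.tau h) ≪ Q ∧ Q ≪ Q.map (EntropicMeasure.tau h)) ∧
      AEMeasurable (EntropicMeasure.Y β h) Q ∧
      Q.map (EntropicMeasure.tau h.symm) =
        Q.withDensity (fun g => ENNReal.ofReal (EntropicMeasure.Y β h g)) ∧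
      -- quasi-invariance of the entropic measure, the image of `Q` under `χ`
      ((Q.map EntropicMeasure.chi).map (EntropicMeasure.pushforward h) ≪
          Q.map EntropicMeasure.chi ∧
        Q.map EntropicMeasure.chi ≪
          (Q.map EntropicMeasure.chi).map (EntropicMeasure.pushforward h)) ∧
      AEMeasurable (EntropicMeasure.gapDensity β h) (Q.map EntropicMeasure.chi) ∧
      (Q.map EntropicMeasure.chi).map (EntropicMeasure.pushforward h.symm) =
        (Q.map EntropicMeasure.chi).withDensity
          (fun μ => ENNReal.ofReal (EntropicMeasure.gapDensity β h μ)) := by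
  open EntropicMeasure in
  refine ⟨fun g => (hh.hasProd_jumps g).multipliable, hh.exists_Y_bounds β,
    fun μ => (hh.hasProd_gaps μ).multipliable, fun Q hQ => ?_⟩
  -- The lemma is applied to `h.symm`, whose inverse is `h`.
  have hac : Q.map (tau h) ≪ Q ∧ Q ≪ Q.map (tau h) :=
    hQ.absolutelyContinuous_tau_symm hβ hh.symm
  have hgap : gapDensity β h ∘ chi =ᵐ[Q] Y β h := by
    filter_upwards [hQ.ae_apply_zero hβ, hQ.ae_leftLim_one hβ] with g h0 h1
    exact hh.gapDensity_chi β h0 h1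
  refine ⟨hac, hQ.aemeasurable_Y hβ hh, hQ.map_tau_symm hβ hh, ?_, ?_, ?_⟩
  · rw [map_pushforward_map_chi]
    exact ⟨hac.1.map measurable_chi, hac.2.map measurable_chi⟩
  · exact chiEquiv.measurableEmbedding.aemeasurable_map_iff.2
      ((hQ.aemeasurable_Y hβ hh).congr hgap.symm)
  · rw [map_pushforward_map_chi, hQ.map_tau_symm hβ hh, ← map_chi_withDensity]
    congr 1
    refine withDensity_congr_ae ?_
    filter_upwards [hgap] with g hg
    rw [Function.comp_apply, ← hg, Function.comp_apply]
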